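/- Let $\mathcal W=\mathbb C\langle a,a^\dagger\rangle/(aa^\dagger-a^\dagger a-1)$ be the Heisenberg–Weyl algebra, and let $\mathcal W_c=\mathbb C[\alpha,\alpha^*]$ be the polynomial ring in two commuting indeterminates. For $s\in\mathbb C$, the $s$-ordering map ${:}\cdot{:}_s:\mathcal W_c\to\mathcal W$ is the $\mathbb C$-linear map defined on monomials by the identity in $\mathcal W[[\beta,\beta^*]]$ $$e^{-s\beta\beta^*/2}\,\exp(\beta a^\dagger-\beta^* a)=\sum_{n,m\ge0}\frac{\beta^n(-\beta^*)^m}{n!\,m!}\;{:}{\alpha^*}^n\alpha^m{:}_s .$$ Normal ordering ${:}\cdot{:}_N$ and anti-normal ordering ${:}\cdot{:}_A$ are the linear maps sending ${\alpha^*}^n\alpha^m$ to ${a^\dagger}^n a^m$ and to $a^m{a^\dagger}^n$ respectively. All three maps are extended coefficientwise to $\mathcal W_c[[\lambda]]\to\mathcal W[[\lambda]]$. For complex $A,B,r,r',s$ define formal power series in $\mathbb C[[D]]$ by $$g_T(D;B,r,r';s)=\tfrac{1+s}2\left[\frac{1+\frac{1-s}2BD}{1-\frac{1+s}2BD}\right]^{-r/B}+\tfrac{1-s}2\left[\frac{1-\frac{1+s}2BD}{1+\frac{1-s}2BD}\right]^{r'/B},$$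 $$f_T(D;A,B;s)=\frac{[1-\frac{1+s}2BD]^{-A/B}-1}{A}+\frac{[1+\frac{1-s}2BD]^{-A/B}-1}{-A},$$ where for $A=0$ or $B=0$ the (coefficientwise) limits are taken. Let $\bar f_T(z)$ be the compositional inverse of $f_T$ and let $\bar g_T(z)=1/g_T(\bar f_T(z))$. The two-point Hsu–Shiue EGF is $$\mathcal T(t,z;A,B,r,r';s)=\bar g_T(z)\,e^{t\bar f_T(z)}\in\mathbb C[t][[z]].$$ **Theorem.** Let $L,R\ge0$ be integers with $e=L+R-1\ge0$, and take the parameters $(A,B,r,r')=(e,1,-L,R)$. 1. For every $s\in\mathbb C$, the pair $[\bar g_T,\bar f_T]$ is the two-sided inverse of $[g_T,f_T]$ for the exponential-Riordan product $[d_1,h_1][d_2,h_2]=[(d_2\circ h_1)\,d_1,\;h_2\circ h_1]$, whose identity is $[1,z]$, and in $\mathcal W[[\lambda]]$ $$e^{\lambda {a^\dagger}^La{a^\dagger}^R}={:}\,\mathcal T(\alpha^*\alpha,\lambda{\alpha^*}^e;e,1,-L,R;s)\,{:}_s={:}\,\bar g_T(\lambda{\alpha^*}^e)\exp\!\big[\alpha^*\alpha\,\bar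 f_T(\lambda{\alpha^*}^e)\big]{:}_s .$$ 2. For $s=-1$, in $\mathcal W_c[[\lambda]]$, $$\mathcal T(\alpha^*\alpha,\lambda{\alpha^*}^e;e,1,-L,R;-1)=(1-e\lambda{\alpha^*}^e)^{-R/e}\exp\!\big\{\big[(1-e\lambda{\alpha^*}^e)^{-1/e}-1\big]\alpha^*\alpha\big\},$$ and ${:}\cdot{:}_N$ of the right-hand side equals $e^{\lambda {a^\dagger}^La{a^\dagger}^R}$. 3. For $s=+1$, in $\mathcal W_c[[\lambda]]$, $$\mathcal T(\alpha^*\alpha,\lambda{\alpha^*}^e;e,1,-L,R;+1)=\exp\!\big\{-\alpha\alpha^*\big[(1+e\lambda{\alpha^*}^e)^{-1/e}-1\big]\big\}(1+e\lambda{\alpha^*}^e)^{-L/e},$$ and ${:}\cdot{:}_A$ of the right-hand side equals $e^{\lambda {a^\dagger}^La{a^\dagger}^R}$. In 2 and 3, for $e=0$ the formal limit $e\to0$ is taken: $(1\pm e u)^{c/e}$ is read as $e^{\pm cu}$. -/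

import Mathlib

open scoped PowerSeries

noncomputable section

namespace BosonOrdering

/-! ### The Heisenberg-Weyl algebra -/

/-- The two generating symbols. -/
inductive Ladder : Type
  | ann
  | cre

/-- The canonical commutation relation `a a† - a† a = 1` imposed on the free algebra. -/
inductive CCR : FreeAlgebra ℂ Ladder → FreeAlgebra ℂ Ladder → Prop
  | comm : CCR (FreeAlgebra.ι ℂ Ladder.ann * FreeAlgebra.ι ℂ Ladder.cre
      - FreeAlgebra.ι ℂ Ladder.cre * FreeAlgebra.ι ℂ Ladder.ann) 1

/-- The Heisenberg-Weyl algebra `𝒲 = ℂ⟨a, a†⟩ / (a a† - a† a - 1)`. -/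
abbrev W : Type := RingQuot CCR

/-- The annihilation operator `a`. -/
def a : W := RingQuot.mkAlgHom ℂ CCR (FreeAlgebra.ι ℂ Ladder.ann)

/-- The creation operator `a†`. -/
def adag : W := RingQuot.mkAlgHom ℂ CCR (FreeAlgebra.ι ℂ Ladder.cre)

/-- `exp (λ G) = ∑ Gⁿ λⁿ / n!` in `𝒲[[λ]]`. -/
def expLambda (G : W) : W⟦X⟧ :=
  PowerSeries.mk fun n => ((n.factorial : ℂ)⁻¹) • G ^ n

/-! ### Classical symbols and quantization maps -/

/-- The commutative polynomial ring `𝒲_c = ℂ[α, α*]`. -/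
abbrev Wc : Type := MvPolynomial (Fin 2) ℂ

/-- The classical indeterminate `α`. -/
def al : Wc := MvPolynomial.X 0

/-- The classical indeterminate `α*`. -/
def als : Wc := MvPolynomial.X 1

/-- The exponential `∑ uᵖ / p!` of an element `u` of `𝒲[[β, β*]]` without constant term
(variable `0` is `β`, variable `1` is `β*`).  As `uᵖ` has no terms of total degree less than `p`,
the coefficient of `βⁿ β*ᵐ` only receives contributions from `p ≤ n + m`. -/
def expBeta (u : MvPowerSeries (Fin 2) W) : MvPowerSeries (Fin 2) W := fun d =>
  ∑ p ∈ Finset.range (d 0 + d 1 + 1), ((p.factorial : ℂ)⁻¹) • MvPowerSeries.coeff d (u ^ p)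

/-- The element `D(β, β*) = exp (β a† - β* a)` of `𝒲[[β, β*]]`. -/
def displacement : MvPowerSeries (Fin 2) W :=
  expBeta (MvPowerSeries.X 0 * MvPowerSeries.C adag - MvPowerSeries.X 1 * MvPowerSeries.C a)

/-- The deformation `D(β, β*; s) = exp (s β (-β*) / 2) D(β, β*)`. -/
def displacementS (s : ℂ) : MvPowerSeries (Fin 2) W :=
  expBeta (-(MvPowerSeries.C (algebraMap ℂ W (s / 2)) * MvPowerSeries.X 0 * MvPowerSeries.X 1))
    * displacement

/-- The `s`-quantization of the monomial `α*ⁿ αᵐ`, determined by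
`D(β, β*; s) = ∑ βⁿ (-β*)ᵐ / (n! m!) :α*ⁿ αᵐ:ₛ`. -/
def sMonomial (s : ℂ) (n m : ℕ) : W :=
  ((n.factorial : ℂ) * (m.factorial : ℂ) * (-1) ^ m) •
    MvPowerSeries.coeff (Finsupp.single 0 n + Finsupp.single 1 m) (displacementS s)

/-- The linear map `𝒲_c → 𝒲` with prescribed values `q n m` on the monomials `α*ⁿ αᵐ`. -/
def quantize (q : ℕ → ℕ → W) : Wc →ₗ[ℂ] W :=
  (MvPolynomial.basisMonomials (Fin 2) ℂ).constr ℂ fun d => q (d 1) (d 0)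

/-- The coefficientwise extension `𝒲_c[[λ]] → 𝒲[[λ]]` of `quantize q`. -/
def quantizeSeries (q : ℕ → ℕ → W) (F : Wc⟦X⟧) : W⟦X⟧ :=
  PowerSeries.mk fun k => quantize q (PowerSeries.coeff k F)

/-- `s`-ordering `:F:ₛ` on `𝒲_c[[λ]]`. -/
def sOrder (s : ℂ) : Wc⟦X⟧ → W⟦X⟧ := quantizeSeries (sMonomial s)

/-- Normal ordering `:F:_N` on `𝒲_c[[λ]]`, sending `α*ⁿ αᵐ` to `a†ⁿ aᵐ`. -/
def normalOrder : Wc⟦X⟧ → W⟦X⟧ := quantizeSeries fun n m => adag ^ n * a ^ m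

/-- Anti-normal ordering `:F:_A` on `𝒲_c[[λ]]`, sending `α*ⁿ αᵐ` to `aᵐ a†ⁿ`. -/
def antiNormalOrder : Wc⟦X⟧ → W⟦X⟧ := quantizeSeries fun n m => a ^ m * adag ^ n

/-! ### Exponential Riordan pairs -/

/-- The product `[d₁, h₁] [d₂, h₂] = [(d₂ ∘ h₁) d₁, h₂ ∘ h₁]` of the exponential Riordan group. -/
def riordanMul (p q : ℂ⟦X⟧ × ℂ⟦X⟧) : ℂ⟦X⟧ × ℂ⟦X⟧ :=
  (q.1.subst p.2 * p.1, q.2.subst p.2)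

/-- The EGF `d(z) exp (t h(z))` in `ℂ[t][[z]]` of the exponential Riordan pair `[d, h]`. -/
def riordanEGF (d h : ℂ⟦X⟧) : (Polynomial ℂ)⟦X⟧ :=
  PowerSeries.map Polynomial.C d *
    (PowerSeries.exp ℂ).subst
      (PowerSeries.C (Polynomial.X : Polynomial ℂ) * PowerSeries.map Polynomial.C h)

/-! ### The two-point Hsu-Shiue family -/

/-- `(1 + u)^c` for a formal power series `u` without constant term. -/
def onePlusPow (u : ℂ⟦X⟧) (c : ℂ) : ℂ⟦X⟧ := (PowerSeries.binomialSeries ℂ c).subst u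

/-- `log (1 + u)` for a formal power series `u` without constant term. -/
def logOnePlus (u : ℂ⟦X⟧) : ℂ⟦X⟧ := (PowerSeries.log ℂ).subst u

/-- `exp u` for a formal power series `u` without constant term. -/
def expSeries (u : ℂ⟦X⟧) : ℂ⟦X⟧ := (PowerSeries.exp ℂ).subst u

/-- The series `g_T(D; B, r, r'; s)`.  Each power is written as `(1 + (base - 1)) ^ exponent`;
for `B = 0` the coefficientwise limit `B → 0` is used. -/
def gT (B r r' s : ℂ) : ℂ⟦X⟧ :=
  let num : ℂ⟦X⟧ := 1 + PowerSeries.C ((1 - s) / 2 * B) * PowerSeries.X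
  let den : ℂ⟦X⟧ := 1 - PowerSeries.C ((1 + s) / 2 * B) * PowerSeries.X
  if B = 0 then
    PowerSeries.C ((1 + s) / 2) * expSeries (-(PowerSeries.C r * PowerSeries.X)) +
      PowerSeries.C ((1 - s) / 2) * expSeries (-(PowerSeries.C r' * PowerSeries.X))
  else
    PowerSeries.C ((1 + s) / 2) * onePlusPow (num * den⁻¹ - 1) (-r / B) +
      PowerSeries.C ((1 - s) / 2) * onePlusPow (den * num⁻¹ - 1) (r' / B)

/-- The series `f_T(D; A, B; s)`; for `A = 0` or `B = 0` the coefficientwise limits are used. -/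
def fT (A B s : ℂ) : ℂ⟦X⟧ :=
  let u : ℂ⟦X⟧ := -(PowerSeries.C ((1 + s) / 2) * PowerSeries.X)
  let v : ℂ⟦X⟧ := PowerSeries.C ((1 - s) / 2) * PowerSeries.X
  if A = 0 then
    if B = 0 then v - u
    else PowerSeries.C (1 / B) *
      (logOnePlus (PowerSeries.C B * v) - logOnePlus (PowerSeries.C B * u))
  else
    if B = 0 then
      PowerSeries.C (1 / A) * (expSeries (-(PowerSeries.C A * u)) - 1) +
        PowerSeries.C (1 / (-A)) * (expSeries (-(PowerSeries.C A * v)) - 1)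
    else
      PowerSeries.C (1 / A) * (onePlusPow (PowerSeries.C B * u) (-A / B) - 1) +
        PowerSeries.C (1 / (-A)) * (onePlusPow (PowerSeries.C B * v) (-A / B) - 1)

theorem coeff_one_subst (f : ℂ⟦X⟧) (c : ℂ) :
    PowerSeries.coeff 1 (f.subst (PowerSeries.C c * PowerSeries.X : ℂ⟦X⟧)) =
      c * PowerSeries.coeff 1 f := by
  have h := PowerSeries.rescale_eq_subst c f
  rw [PowerSeries.smul_eq_C_mul] at h
  rw [← h, PowerSeries.coeff_rescale, pow_one]

theorem coeff_one_fT (A B s : ℂ) : PowerSeries.coeff 1 (fT A B s) = 1 := by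
  have e1 : ∀ b c : ℂ, (PowerSeries.C b * (PowerSeries.C c * PowerSeries.X) : ℂ⟦X⟧) =
      PowerSeries.C (b * c) * PowerSeries.X := by
    intro b c; rw [map_mul, mul_assoc]
  have e2 : ∀ c : ℂ, (-(PowerSeries.C c * PowerSeries.X) : ℂ⟦X⟧) =
      PowerSeries.C (-c) * PowerSeries.X := by
    intro c; rw [map_neg, neg_mul]
  unfold fT
  simp only [e1, e2, expSeries, logOnePlus, onePlusPow]
  split_ifs with hA hB hB <;>
    simp only [map_add, map_sub, PowerSeries.coeff_C_mul, coeff_one_subst, PowerSeries.coeff_one_log,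
      PowerSeries.coeff_one_X, PowerSeries.coeff_exp, PowerSeries.binomialSeries_coeff,
      PowerSeries.coeff_one, Ring.choose_one_right] <;> simp <;> field_simp <;> ring

/-- `f̄_T`, the compositional inverse of `f_T`. -/
def fTbar (A B s : ℂ) : ℂ⟦X⟧ :=
  (fT A B s).substInvOfIsUnit (by rw [coeff_one_fT]; exact isUnit_one)

/-- `ḡ_T = 1 / (g_T ∘ f̄_T)`. -/
def gTbar (A B r r' s : ℂ) : ℂ⟦X⟧ := ((gT B r r' s).subst (fTbar A B s))⁻¹

/-- The two-point Hsu-Shiue EGF `𝒯(t, z; A, B, r, r'; s)`, an element of `ℂ[t][[z]]`. -/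
def twoPointEGF (A B r r' s : ℂ) : (Polynomial ℂ)⟦X⟧ :=
  riordanEGF (gTbar A B r r' s) (fTbar A B s)

/-! ### Substitution of `(t, z) = (α* α, λ α*ᵉ)` -/

/-- `F(α* α, λ α*ᵉ)` in `𝒲_c[[λ]]`, for `F(t, z)` in `ℂ[t][[z]]`. -/
def substTZ (e : ℕ) (F : (Polynomial ℂ)⟦X⟧) : Wc⟦X⟧ :=
  PowerSeries.rescale (als ^ e)
    (PowerSeries.map (Polynomial.aeval (als * al)).toRingHom F)

/-- `φ(λ α*ᵉ)` in `𝒲_c[[λ]]`, for `φ(z)` in `ℂ[[z]]`. -/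
def substZ (e : ℕ) (φ : ℂ⟦X⟧) : Wc⟦X⟧ :=
  PowerSeries.rescale (als ^ e) (PowerSeries.map MvPolynomial.C φ)

/-- `exp (w ψ)` in `𝒲_c[[λ]]`, for `w` in `𝒲_c` and `ψ` in `𝒲_c[[λ]]` without constant term. -/
def expWc (w : Wc) (ψ : Wc⟦X⟧) : Wc⟦X⟧ := (PowerSeries.exp ℂ).subst (PowerSeries.C w * ψ)

/-- `(1 + e u)^(c / e)` for `u` without constant term, with its limit `exp (c u)` at `e = 0`. -/
def stridePow (e : ℕ) (u : ℂ⟦X⟧) (c : ℂ) : ℂ⟦X⟧ :=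
  if e = 0 then expSeries (PowerSeries.C c * u)
  else onePlusPow (PowerSeries.C (e : ℂ) * u) (c / e)

/-- `(1 - e λ α*ᵉ)^(-R/e) exp {[(1 - e λ α*ᵉ)^(-1/e) - 1] α* α}`. -/
def normalForm (e R : ℕ) : Wc⟦X⟧ :=
  substZ e (stridePow e (-PowerSeries.X) (-R)) *
    expWc (als * al) (substZ e (stridePow e (-PowerSeries.X) (-1) - 1))

/-- `exp {-α α* [(1 + e λ α*ᵉ)^(-1/e) - 1]} (1 + e λ α*ᵉ)^(-L/e)`. -/
def antiNormalForm (e L : ℕ) : Wc⟦X⟧ :=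
  expWc (-(al * als)) (substZ e (stridePow e PowerSeries.X (-1) - 1)) *
    substZ e (stridePow e PowerSeries.X (-L))

end BosonOrdering

end

open BosonOrdering

open scoped PowerSeries

noncomputable section

namespace BosonOrdering

/-! ### Commutation relations and ordered monomials -/

/-! Put p = (1+s)/2 and q = 1-p. The s-ordered monomials O(n,m) are determined by O(0,m) = a^m and
a† O(n,m) = O(n+1,m) - p m O(n,m-1), and they then also satisfy a O(n,m) = O(n,m+1) + q n O(n-1,m)
(`a_mul_ordered`). `sMonomial_eq` extracts this from the generating function: the displacement
operator satisfies β∂_β D = (βa† - ββ*/2) D, and the central factor exp(-sββ*/2) turns 1/2 into p.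

Each factor G = a†^L a a†^R raises the excess of creators over annihilators by e, so the λ^k
coefficient of exp(λG) is sought as the quantization of α*^(ek) P_k(α*α). On such symbols left
multiplication by a† is 1 - p∂_t, and by a it is t + q(n+1 + t∂_t), where n is the exponent of α*
after lowering. The recursion (k+1) c_(k+1) = G c_k becomes a linear PDE for F(t,z) = ∑ P_k(t) z^k.

For F = d(z) e^(t h(z)), ∂_t is multiplication by h, and comparing powers of t splits the PDE into
one ODE for h and one for d (`generator_mul_quantizeDiag`). With P = 1-ph, Q = 1+qh and M = pQ^(e+1)
+ qP^(e+1), the pair h = f̄_T, d = ḡ_T satisfies e z P^e Q^e = Q^e - P^e, h' M = (PQ)^(e+1) and d M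
= P^L Q^R. The two ODEs follow from these relations and pQ + qP = 1 (`derivative_eq_of_relations`,
`derivative_eq_of_relations'`).

At s = -1 one has P = M = 1, and at s = 1 one has Q = M = 1. Then d is Q^R or P^L, and Q or P solves
a first-order linear ODE whose solution is the stated power. -/

theorem a_mul_adag : a * adag = adag * a + 1 := by
  have h := RingQuot.mkAlgHom_rel ℂ CCR.comm
  simp only [map_sub, map_mul, map_one] at h
  exact sub_eq_iff_eq_add'.mp h

theorem a_mul_adag_pow (n : ℕ) : a * adag ^ n = adag ^ n * a + (n : ℂ) • adag ^ (n - 1) := by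
  induction n with
  | zero => simp
  | succ n ih =>
    rw [pow_succ, ← mul_assoc, ih, add_mul, mul_assoc, a_mul_adag, Nat.add_sub_cancel, mul_add,
      mul_one, ← mul_assoc, smul_mul_assoc, Nat.cast_succ, add_smul, one_smul, add_assoc]
    rcases n with _ | n
    · simp
    · rw [Nat.add_sub_cancel, ← pow_succ adag n, add_comm (adag ^ (n + 1))]

theorem a_pow_mul_adag (m : ℕ) : a ^ m * adag = adag * a ^ m + (m : ℂ) • a ^ (m - 1) := by
  induction m with
  | zero => simp
  | succ m ih =>
    rw [pow_succ', mul_assoc, ih, mul_add, ← mul_assoc, a_mul_adag, Nat.add_sub_cancel, add_mul,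
      one_mul, mul_assoc, mul_smul_comm, Nat.cast_succ, add_smul, one_smul, add_assoc]
    rcases m with _ | m
    · simp
    · rw [Nat.add_sub_cancel, ← pow_succ' a m, add_comm (a ^ (m + 1))]

/-- The ordered monomials, interpolating between the normal order (`p = 0`) and the anti-normal
order (`p = 1`). -/
def ordered (p : ℂ) : ℕ → ℕ → W
  | 0, m => a ^ m
  | n + 1, m => adag * ordered p n m + (p * m) • ordered p n (m - 1)

theorem ordered_zero_left (p : ℂ) (m : ℕ) : ordered p 0 m = a ^ m := rfl

theorem ordered_succ (p : ℂ) (n m : ℕ) :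
    ordered p (n + 1) m = adag * ordered p n m + (p * m) • ordered p n (m - 1) := rfl

theorem adag_mul_ordered (p : ℂ) (n m : ℕ) :
    adag * ordered p n m = ordered p (n + 1) m - (p * m) • ordered p n (m - 1) := by
  rw [ordered_succ, add_sub_cancel_right]

/-- The commutator [a, a†] = 1 is shared between the two multiplications: a† carries the weight p,
and a the remaining 1 - p. -/
theorem a_mul_ordered (p : ℂ) (n m : ℕ) :
    a * ordered p n m = ordered p n (m + 1) + ((1 - p) * n) • ordered p (n - 1) m := by
  induction n generalizing m with
  | zero => simp [ordered_zero_left, pow_succ']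
  | succ n ih =>
    have h1 : adag * ordered p (n - 1) m = ordered p (n - 1 + 1) m -
      (p * m) • ordered p (n - 1) (m - 1) := adag_mul_ordered p _ _
    rw [ordered_succ, mul_add, ← mul_assoc, a_mul_adag, add_mul, one_mul, mul_assoc, ih,
      mul_smul_comm, ih, mul_add, adag_mul_ordered, mul_smul_comm, h1]
    -- The truncated indices n - 1 and m - 1 only occur with a factor n or m that vanishes at 0; the
    -- case split makes this visible.
    rcases m with _ | m <;> rcases n with _ | n <;> push_cast <;>
      simp <;> module

theorem ordered_zero (n m : ℕ) : ordered 0 n m = adag ^ n * a ^ m := by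
  induction n with
  | zero => simp [ordered_zero_left]
  | succ n ih => simp [ordered_succ, ih, pow_succ', mul_assoc]

theorem ordered_one (n m : ℕ) : ordered 1 n m = a ^ m * adag ^ n := by
  induction n generalizing m with
  | zero => simp [ordered_zero_left]
  | succ n ih =>
    rw [ordered_succ, ih, ih, pow_succ', ← mul_assoc, ← mul_assoc, a_pow_mul_adag, add_mul,
      one_mul, smul_mul_assoc]

/-! ### The exponential and Euler operators -/

/-- Multiplication of the coefficient at `d` by `w d`; a derivation for additive weights `w`. -/
def euler (w : (Fin 2 →₀ ℕ) →+ ℕ) (F : MvPowerSeries (Fin 2) W) : MvPowerSeries (Fin 2) W :=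
  fun d => w d • MvPowerSeries.coeff d F

theorem coeff_euler (w : (Fin 2 →₀ ℕ) →+ ℕ) (F : MvPowerSeries (Fin 2) W) (d : Fin 2 →₀ ℕ) :
    MvPowerSeries.coeff d (euler w F) = w d • MvPowerSeries.coeff d F := rfl

theorem euler_mul (w : (Fin 2 →₀ ℕ) →+ ℕ) (F G : MvPowerSeries (Fin 2) W) :
    euler w (F * G) = euler w F * G + F * euler w G := by
  classical
  ext d
  rw [map_add, coeff_euler, MvPowerSeries.coeff_mul, MvPowerSeries.coeff_mul,
    MvPowerSeries.coeff_mul, ← Finset.sum_add_distrib, Finset.smul_sum]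
  refine Finset.sum_congr rfl fun x hx => ?_
  rw [coeff_euler, coeff_euler, ← Finset.HasAntidiagonal.mem_antidiagonal.mp hx, map_add, add_smul,
    smul_mul_assoc, mul_smul_comm]

/-- Homogeneity of weight one makes the derivative of u equal to u itself, hence commute with u.
This is why the power rule survives in a noncommutative ring, and why the total degree is the weight
used for the displacement operator. -/
theorem euler_pow {w : (Fin 2 →₀ ℕ) →+ ℕ} {u : MvPowerSeries (Fin 2) W} (h : euler w u = u)
    (k : ℕ) : euler w (u ^ k) = k • u ^ k := by
  classical
  induction k with
  | zero =>
    ext d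
    rw [coeff_euler, zero_smul, map_zero, pow_zero, MvPowerSeries.coeff_one]
    split_ifs with hd
    · rw [hd, map_zero, zero_smul]
    · rw [smul_zero]
  | succ k ih => rw [pow_succ, euler_mul, ih, h, succ_nsmul, smul_mul_assoc]

theorem coeff_pow_eq_zero {u : MvPowerSeries (Fin 2) W} (h : MvPowerSeries.coeff 0 u = 0)
    {d : Fin 2 →₀ ℕ} {p : ℕ} (hp : d 0 + d 1 < p) : MvPowerSeries.coeff d (u ^ p) = 0 := by
  classical
  induction p generalizing d with
  | zero => omega
  | succ p ih =>
    rw [pow_succ, MvPowerSeries.coeff_mul]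
    refine Finset.sum_eq_zero fun x hx => ?_
    have hx := Finset.HasAntidiagonal.mem_antidiagonal.mp hx
    by_cases h2 : x.2 = 0
    · rw [h2, h, mul_zero]
    · rw [ih, zero_mul]
      have h0 : x.1 0 + x.2 0 = d 0 := by rw [← hx]; rfl
      have h1 : x.1 1 + x.2 1 = d 1 := by rw [← hx]; rfl
      have : x.2 0 + x.2 1 ≠ 0 := fun h => h2 (by
        ext i; fin_cases i <;> simp <;> omega)
      omega

/-- The cutoff in `expBeta` may be raised freely, since the added terms vanish; sums with different
cutoffs can then be compared. -/
theorem coeff_expBeta {u : MvPowerSeries (Fin 2) W} (h : MvPowerSeries.coeff 0 u = 0)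
    {d : Fin 2 →₀ ℕ} {N : ℕ} (hN : d 0 + d 1 < N) :
    MvPowerSeries.coeff d (expBeta u) =
      ∑ p ∈ Finset.range N, ((p.factorial : ℂ)⁻¹) • MvPowerSeries.coeff d (u ^ p) := by
  refine Finset.sum_subset (Finset.range_subset_range.mpr hN) fun p _ hp => ?_
  rw [coeff_pow_eq_zero h (by simpa using hp), smul_zero]

theorem coeff_mul_expBeta {u : MvPowerSeries (Fin 2) W} (h : MvPowerSeries.coeff 0 u = 0)
    (v : MvPowerSeries (Fin 2) W) {d : Fin 2 →₀ ℕ} {N : ℕ} (hN : d 0 + d 1 < N) :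
    MvPowerSeries.coeff d (v * expBeta u) =
      ∑ p ∈ Finset.range N, ((p.factorial : ℂ)⁻¹) • MvPowerSeries.coeff d (v * u ^ p) := by
  classical
  simp_rw [MvPowerSeries.coeff_mul, Finset.smul_sum]
  rw [Finset.sum_comm]
  refine Finset.sum_congr rfl fun x hx => ?_
  have hx := Finset.HasAntidiagonal.mem_antidiagonal.mp hx
  have h0 : x.1 0 + x.2 0 = d 0 := by rw [← hx]; rfl
  have h1 : x.1 1 + x.2 1 = d 1 := by rw [← hx]; rfl
  rw [coeff_expBeta h (N := N) (by omega), Finset.mul_sum]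
  simp_rw [mul_smul_comm]

theorem euler_expBeta {w : (Fin 2 →₀ ℕ) →+ ℕ} {u : MvPowerSeries (Fin 2) W}
    (h : MvPowerSeries.coeff 0 u = 0) (hu : euler w u = u) :
    euler w (expBeta u) = u * expBeta u := by
  ext d
  -- The left cutoff is one larger than the right one: the Euler operator kills the term p = 0, and
  -- the shift p ↦ p + 1 matches the rest.
  rw [coeff_euler, coeff_expBeta h (N := d 0 + d 1 + 2) (by omega),
    coeff_mul_expBeta h u (N := d 0 + d 1 + 1) (by omega), Finset.sum_range_succ', smul_add,
    Finset.smul_sum]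
  have h0 := coeff_euler w (u ^ 0) d
  rw [euler_pow hu, zero_smul, map_zero] at h0
  rw [smul_comm, ← h0, smul_zero, add_zero]
  refine Finset.sum_congr rfl fun p _ => ?_
  have h1 := coeff_euler w (u ^ (p + 1)) d
  rw [euler_pow hu, map_nsmul] at h1
  rw [smul_comm, ← h1, ← pow_succ', ← Nat.cast_smul_eq_nsmul ℂ, smul_smul, Nat.factorial_succ]
  congr 1
  have : (p.factorial : ℂ) ≠ 0 := by exact_mod_cast p.factorial_ne_zero
  have : ((p : ℂ) + 1) ≠ 0 := by exact_mod_cast p.succ_ne_zero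
  push_cast
  field_simp

theorem coeff_zero_expBeta (u : MvPowerSeries (Fin 2) W) :
    MvPowerSeries.coeff 0 (expBeta u) = 1 := by
  rw [MvPowerSeries.coeff_apply, expBeta]; simp

/-! ### Coefficients of the displacement operators -/

/-- The exponent of `βⁿ β*ᵐ`. -/
abbrev bideg (n m : ℕ) : Fin 2 →₀ ℕ := Finsupp.single 0 n + Finsupp.single 1 m

theorem bideg_zero (n m : ℕ) : bideg n m 0 = n := by simp [bideg]

theorem bideg_one (n m : ℕ) : bideg n m 1 = m := by simp [bideg]

theorem eq_bideg (d : Fin 2 →₀ ℕ) : d = bideg (d 0) (d 1) := by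
  ext i
  fin_cases i <;> simp [bideg]

theorem bideg_le_bideg {i j n m : ℕ} : bideg i j ≤ bideg n m ↔ i ≤ n ∧ j ≤ m := by
  refine ⟨fun h => ⟨?_, ?_⟩, fun h => add_le_add ?_ ?_⟩
  · simpa only [bideg_zero] using h 0
  · simpa only [bideg_one] using h 1
  · exact Finsupp.single_le_single.mpr h.1
  · exact Finsupp.single_le_single.mpr h.2

theorem bideg_sub_bideg (i j n m : ℕ) : bideg n m - bideg i j = bideg (n - i) (m - j) := by
  ext k
  fin_cases k <;> simp [bideg]

theorem coeff_bideg_monomial_mul (i j n m : ℕ) (c : W) (F : MvPowerSeries (Fin 2) W) :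
    MvPowerSeries.coeff (bideg n m) (MvPowerSeries.monomial (bideg i j) c * F) =
      if i ≤ n ∧ j ≤ m then c * MvPowerSeries.coeff (bideg (n - i) (m - j)) F else 0 := by
  simp only [MvPowerSeries.coeff_monomial_mul, bideg_le_bideg, bideg_sub_bideg]

theorem euler_monomial (w : (Fin 2 →₀ ℕ) →+ ℕ) (d : Fin 2 →₀ ℕ) (c : W) :
    euler w (MvPowerSeries.monomial d c) = w d • MvPowerSeries.monomial d c := by
  classical
  ext d'
  rw [coeff_euler, map_nsmul, MvPowerSeries.coeff_monomial]
  split_ifs with h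
  · rw [h]
  · simp

/-- The degree in the variable `i`. -/
def degVar (i : Fin 2) : (Fin 2 →₀ ℕ) →+ ℕ := Finsupp.applyAddHom i

theorem degVar_apply (i : Fin 2) (d : Fin 2 →₀ ℕ) : degVar i d = d i := rfl

theorem displacement_eq : displacement = expBeta
    (MvPowerSeries.monomial (bideg 1 0) adag - MvPowerSeries.monomial (bideg 0 1) a) := by
  have h (i : Fin 2) (c : W) : MvPowerSeries.X i * MvPowerSeries.C c =
      MvPowerSeries.monomial (Finsupp.single i 1) c := by
    rw [MvPowerSeries.X, ← MvPowerSeries.monomial_zero_eq_C_apply,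
      MvPowerSeries.monomial_mul_monomial, add_zero, one_mul]
  rw [displacement, h, h]
  simp [bideg]

theorem coeff_displacement_rec (n m : ℕ) :
    ((n : ℂ) + m) • MvPowerSeries.coeff (bideg n m) displacement =
      (if n = 0 then 0 else adag * MvPowerSeries.coeff (bideg (n - 1) m) displacement) -
      (if m = 0 then 0 else a * MvPowerSeries.coeff (bideg n (m - 1)) displacement) := by
  have h : euler (degVar 0 + degVar 1) displacement =
      (MvPowerSeries.monomial (bideg 1 0) adag - MvPowerSeries.monomial (bideg 0 1) a)
        * displacement := by
    rw [displacement_eq]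
    apply euler_expBeta
    · rw [show (0 : Fin 2 →₀ ℕ) = bideg 0 0 by simp [bideg]]
      have h1 := coeff_bideg_monomial_mul 1 0 0 0 adag 1
      have h2 := coeff_bideg_monomial_mul 0 1 0 0 a 1
      rw [mul_one] at h1 h2
      rw [map_sub, h1, h2]
      simp
    · have hs (F G : MvPowerSeries (Fin 2) W) (w) : euler w (F - G) = euler w F - euler w G := by
        ext d
        simp only [coeff_euler, map_sub, smul_sub]
      rw [hs, euler_monomial, euler_monomial]
      simp [degVar_apply, bideg]
  have h2 := congrArg (MvPowerSeries.coeff (bideg n m)) h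
  rw [coeff_euler, sub_mul, map_sub, coeff_bideg_monomial_mul, coeff_bideg_monomial_mul,
    ← Nat.cast_smul_eq_nsmul ℂ, AddMonoidHom.add_apply, degVar_apply, degVar_apply, bideg_zero,
    bideg_one, Nat.cast_add] at h2
  rw [h2]
  rcases n with _ | n <;> rcases m with _ | m <;> simp

/-- In the total-degree recursion, a† contributes -p n m and a contributes +(1-p) n m to the lower
term `ordered p (n - 1) (m - 1)`. These cancel exactly when p = 1/2, the symmetric ordering. -/
theorem coeff_displacement (n m : ℕ) : MvPowerSeries.coeff (bideg n m) displacement =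
    ((-1) ^ m * (n.factorial : ℂ)⁻¹ * (m.factorial : ℂ)⁻¹) • ordered (1 / 2) n m := by
  induction hk : n + m generalizing n m with
  | zero =>
    obtain ⟨rfl, rfl⟩ : n = 0 ∧ m = 0 := by omega
    rw [show bideg 0 0 = 0 by simp [bideg], displacement, coeff_zero_expBeta]
    simp [ordered_zero_left]
  | succ k ih =>
    have hne : (n : ℂ) + m ≠ 0 := by
      rw [← Nat.cast_add, hk]
      exact_mod_cast k.succ_ne_zero
    -- The recursion gives only n + m times the coefficient, so that nonzero scalar is cancelled.
    apply smul_right_injective W hne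
    beta_reduce
    rw [coeff_displacement_rec]
    have hf (j : ℕ) : (j.factorial : ℂ) ≠ 0 := by exact_mod_cast j.factorial_ne_zero
    have hs (j : ℕ) : (j : ℂ) + 1 ≠ 0 := by exact_mod_cast j.succ_ne_zero
    rcases n with _ | n <;> rcases m with _ | m
    · omega
    · rw [if_pos rfl, if_neg (by omega), Nat.add_sub_cancel, ih 0 m (by omega), mul_smul_comm,
        a_mul_ordered, Nat.factorial_succ]
      have := hf m
      have := hs m
      push_cast
      match_scalars <;> field_simp <;> ring
    · rw [if_pos rfl, if_neg (by omega), Nat.add_sub_cancel, ih n 0 (by omega), mul_smul_comm,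
        adag_mul_ordered, Nat.factorial_succ]
      have := hf n
      have := hs n
      push_cast
      match_scalars <;> field_simp <;> ring
    · rw [if_neg (by omega), if_neg (by omega), Nat.add_sub_cancel, Nat.add_sub_cancel,
        ih n (m + 1) (by omega), ih (n + 1) m (by omega), mul_smul_comm, mul_smul_comm,
        adag_mul_ordered, a_mul_ordered, Nat.factorial_succ, Nat.factorial_succ,
        Nat.add_sub_cancel, Nat.add_sub_cancel]
      have := hf n
      have := hs n
      have := hf m
      have := hs m
      push_cast
      match_scalars <;> field_simp <;> ring

/-- Here the exponent is not homogeneous of weight one, so the power rule is unavailable; the term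
-ββ*/2 is the commutator correction. The identity is read off from the coefficients already found.
-/
theorem euler_degVar_zero_displacement : euler (degVar 0) displacement =
    (MvPowerSeries.monomial (bideg 1 0) adag -
      MvPowerSeries.monomial (bideg 1 1) (algebraMap ℂ W (1 / 2))) * displacement := by
  ext d
  rw [eq_bideg d]
  generalize d 0 = n
  generalize d 1 = m
  rw [coeff_euler, sub_mul, map_sub, coeff_bideg_monomial_mul, coeff_bideg_monomial_mul,
    degVar_apply, bideg_zero, ← Nat.cast_smul_eq_nsmul ℂ]
  have hf (j : ℕ) : (j.factorial : ℂ) ≠ 0 := by exact_mod_cast j.factorial_ne_zero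
  have hs (j : ℕ) : (j : ℂ) + 1 ≠ 0 := by exact_mod_cast j.succ_ne_zero
  rcases n with _ | n
  · simp
  · have := hf n
    have := hs n
    rw [if_pos (by omega), coeff_displacement, coeff_displacement, Nat.add_sub_cancel,
      mul_smul_comm, Nat.sub_zero, adag_mul_ordered, Nat.factorial_succ]
    rcases m with _ | m
    · rw [if_neg (by omega)]
      push_cast
      match_scalars
      all_goals field_simp
      all_goals ring
    · have := hf m
      have := hs m
      rw [if_pos (by omega), coeff_displacement, Nat.add_sub_cancel, ← Algebra.smul_def,
        Nat.factorial_succ]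
      push_cast
      match_scalars
      all_goals field_simp
      all_goals ring

/-- The scalar factor `exp (-s β β* / 2)`. -/
def scalarFactor (s : ℂ) : MvPowerSeries (Fin 2) W :=
  expBeta (MvPowerSeries.monomial (bideg 1 1) (algebraMap ℂ W (-(s / 2))))

theorem displacementS_eq (s : ℂ) : displacementS s = scalarFactor s * displacement := by
  rw [displacementS, scalarFactor]
  congr 2
  rw [MvPowerSeries.X, MvPowerSeries.X, ← MvPowerSeries.monomial_zero_eq_C_apply,
    MvPowerSeries.monomial_mul_monomial, MvPowerSeries.monomial_mul_monomial, zero_add, mul_one,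
    mul_one, map_neg, map_neg]

theorem euler_scalarFactor (s : ℂ) (i : Fin 2) : euler (degVar i) (scalarFactor s) =
    MvPowerSeries.monomial (bideg 1 1) (algebraMap ℂ W (-(s / 2))) * scalarFactor s := by
  apply euler_expBeta
  · have h := coeff_bideg_monomial_mul 1 1 0 0 (algebraMap ℂ W (-(s / 2))) 1
    rw [mul_one, if_neg (by omega)] at h
    simpa [bideg] using h
  · rw [euler_monomial, degVar_apply]
    fin_cases i <;> simp [bideg]

/-- Scalar coefficients are central, which is what allows the factor to be moved past any series. -/
theorem exists_map_eq_scalarFactor (s : ℂ) :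
    ∃ f : MvPowerSeries (Fin 2) ℂ, scalarFactor s = MvPowerSeries.map (algebraMap ℂ W) f := by
  let f : MvPowerSeries (Fin 2) ℂ := fun d => ∑ p ∈ Finset.range (d 0 + d 1 + 1),
    ((p.factorial : ℂ)⁻¹) •
      MvPowerSeries.coeff d (MvPowerSeries.monomial (bideg 1 1) (-(s / 2)) ^ p)
  refine ⟨f, ?_⟩
  ext d
  have hd : MvPowerSeries.coeff d f = ∑ p ∈ Finset.range (d 0 + d 1 + 1),
    ((p.factorial : ℂ)⁻¹) •
      MvPowerSeries.coeff d (MvPowerSeries.monomial (bideg 1 1) (-(s / 2)) ^ p) := rfl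
  rw [MvPowerSeries.coeff_map, hd, MvPowerSeries.coeff_apply, scalarFactor, expBeta, map_sum]
  refine Finset.sum_congr rfl fun p _ => ?_
  rw [← MvPowerSeries.map_monomial, ← map_pow, MvPowerSeries.coeff_map, smul_eq_mul, map_mul,
    Algebra.smul_def]

theorem scalarFactor_mul_comm (s : ℂ) (F : MvPowerSeries (Fin 2) W) :
    scalarFactor s * F = F * scalarFactor s := by
  classical
  obtain ⟨f, hf⟩ := exists_map_eq_scalarFactor s
  ext d
  rw [hf, MvPowerSeries.coeff_mul, MvPowerSeries.coeff_mul]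
  refine Finset.sum_nbij' Prod.swap Prod.swap ?_ ?_ ?_ ?_ ?_
  · simp [add_comm]
  · simp [add_comm]
  · simp
  · simp
  · intro x _
    rw [Prod.fst_swap, Prod.snd_swap, MvPowerSeries.coeff_map]
    exact Algebra.commutes _ _

theorem coeff_scalarFactor_zero_left (s : ℂ) (m : ℕ) :
    MvPowerSeries.coeff (bideg 0 m) (scalarFactor s) = if m = 0 then 1 else 0 := by
  split_ifs with hm
  · rw [hm, show bideg 0 0 = 0 by simp [bideg], scalarFactor, coeff_zero_expBeta]
  -- The degree in β* is used: the right side has a factor ββ*, so it has no β*^m term, and m times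
  -- the coefficient is zero.
  · have h := congrArg (MvPowerSeries.coeff (bideg 0 m)) (euler_scalarFactor s 1)
    rw [coeff_euler, coeff_bideg_monomial_mul, if_neg (by omega), degVar_apply, bideg_one,
      ← Nat.cast_smul_eq_nsmul ℂ] at h
    exact (smul_eq_zero.mp h).resolve_left (by exact_mod_cast hm)

theorem coeff_displacementS_zero_left (s : ℂ) (m : ℕ) :
    MvPowerSeries.coeff (bideg 0 m) (displacementS s) =
      MvPowerSeries.coeff (bideg 0 m) displacement := by
  classical
  rw [displacementS_eq, MvPowerSeries.coeff_mul, Finset.sum_eq_single (0, bideg 0 m)]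
  · rw [show (0 : Fin 2 →₀ ℕ) = bideg 0 0 by simp [bideg], coeff_scalarFactor_zero_left,
      if_pos rfl, one_mul]
  · rintro ⟨x, y⟩ hmem hne
    have hxy := Finset.HasAntidiagonal.mem_antidiagonal.mp hmem
    have h0 : x 0 + y 0 = 0 := by
      have := DFunLike.congr_fun hxy 0
      rwa [bideg_zero, Finsupp.add_apply] at this
    rw [eq_bideg x, show x 0 = 0 by omega, coeff_scalarFactor_zero_left, if_neg, zero_mul]
    intro h1
    apply hne
    have hx : x = 0 := by rw [eq_bideg x, h1, show x 0 = 0 by omega]; simp [bideg]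
    have hy : y = bideg 0 m := by rw [← hxy, hx, zero_add]
    rw [hx, hy]
  · intro h
    exact absurd (Finset.HasAntidiagonal.mem_antidiagonal.mpr (zero_add _)) h

theorem euler_displacementS (s : ℂ) : euler (degVar 0) (displacementS s) =
    (MvPowerSeries.monomial (bideg 1 0) adag -
      MvPowerSeries.monomial (bideg 1 1) (algebraMap ℂ W ((1 + s) / 2))) * displacementS s := by
  have h : MvPowerSeries.monomial (bideg 1 1) (algebraMap ℂ W ((1 + s) / 2)) =
      MvPowerSeries.monomial (bideg 1 1) (algebraMap ℂ W (1 / 2)) -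
      MvPowerSeries.monomial (bideg 1 1) (algebraMap ℂ W (-(s / 2))) := by
    rw [← map_sub, ← map_sub]
    congr 2
    ring
  rw [displacementS_eq, euler_mul, euler_scalarFactor, euler_degVar_zero_displacement,
    ← mul_assoc (scalarFactor s), scalarFactor_mul_comm, h]
  simp only [sub_mul, mul_assoc]
  abel

/-- The β-equation of `euler_displacementS` is the defining recursion of `ordered` once coefficients
are multiplied by n! m! (-1)^m; the sign turns -p into +p m. The initial values n = 0 do not depend
on s. -/
theorem sMonomial_eq (s : ℂ) : sMonomial s = ordered ((1 + s) / 2) := by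
  have hf (j : ℕ) : (j.factorial : ℂ) ≠ 0 := by exact_mod_cast j.factorial_ne_zero
  have hs (j : ℕ) : (j : ℂ) + 1 ≠ 0 := by exact_mod_cast j.succ_ne_zero
  have hpow (j : ℕ) : ((-1 : ℂ) ^ j) * (-1) ^ j = 1 := by rw [← mul_pow]; simp
  ext n m
  induction n generalizing m with
  | zero =>
    have h : sMonomial s 0 m = (((0 : ℕ).factorial : ℂ) * (m.factorial : ℂ) * (-1) ^ m) •
      MvPowerSeries.coeff (bideg 0 m) (displacementS s) := rfl
    rw [h, coeff_displacementS_zero_left, coeff_displacement, ordered_zero_left,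
      ordered_zero_left, smul_smul]
    have : ((Nat.factorial 0 : ℂ) * m.factorial * (-1) ^ m *
        ((-1) ^ m * (Nat.factorial 0 : ℂ)⁻¹ * (m.factorial : ℂ)⁻¹)) = 1 := by
      have := hf m
      rw [Nat.factorial_zero]
      push_cast
      field_simp
      rw [pow_two, hpow]
    rw [this, one_smul]
  | succ n ih =>
    have h (n m) : sMonomial s n m = ((n.factorial : ℂ) * (m.factorial : ℂ) * (-1) ^ m) •
      MvPowerSeries.coeff (bideg n m) (displacementS s) := rfl
    have key := congrArg (MvPowerSeries.coeff (bideg (n + 1) m)) (euler_displacementS s)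
    rw [coeff_euler, sub_mul, map_sub, coeff_bideg_monomial_mul, coeff_bideg_monomial_mul,
      degVar_apply, bideg_zero, ← Nat.cast_smul_eq_nsmul ℂ, if_pos (by omega),
      Nat.add_sub_cancel, Nat.sub_zero] at key
    have h1 : sMonomial s (n + 1) m = ((n.factorial : ℂ) * (m.factorial : ℂ) * (-1) ^ m) •
        (((n + 1 : ℕ) : ℂ) • MvPowerSeries.coeff (bideg (n + 1) m) (displacementS s)) := by
      rw [h, smul_smul, Nat.factorial_succ]
      congr 1
      push_cast
      ring
    rw [h1, key, smul_sub, ← mul_smul_comm, ← h, ih, ordered_succ, sub_eq_add_neg]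
    congr 1
    rcases m with _ | m
    · simp
    · rw [if_pos (by omega), Nat.add_sub_cancel, ← Algebra.smul_def, ← ih, h, Nat.factorial_succ]
      push_cast
      module

/-! ### Quantization of `α*ⁿ P(α* α)` -/

theorem quantize_monomial (q : ℕ → ℕ → W) (n m : ℕ) : quantize q (als ^ n * al ^ m) = q n m := by
  have h : als ^ n * al ^ m = MvPolynomial.basisMonomials (Fin 2) ℂ (bideg m n) := by
    rw [MvPolynomial.coe_basisMonomials, als, al, MvPolynomial.X_pow_eq_monomial,
      MvPolynomial.X_pow_eq_monomial, MvPolynomial.monomial_mul, mul_one, add_comm]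
  rw [quantize, h, Module.Basis.constr_basis, bideg_zero, bideg_one]

/-- The quantization of `α*ⁿ P(α* α)`. -/
def quantizeDiag (q : ℕ → ℕ → W) (n : ℕ) : Polynomial ℂ →ₗ[ℂ] W :=
  quantize q ∘ₗ LinearMap.mulLeft ℂ (als ^ n) ∘ₗ (Polynomial.aeval (als * al)).toLinearMap

theorem quantizeDiag_apply (q : ℕ → ℕ → W) (n : ℕ) (P : Polynomial ℂ) :
    quantizeDiag q n P = quantize q (als ^ n * Polynomial.aeval (als * al) P) := rfl

theorem quantizeDiag_X_pow (q : ℕ → ℕ → W) (n j : ℕ) :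
    quantizeDiag q n (Polynomial.X ^ j) = q (n + j) j := by
  rw [quantizeDiag_apply, map_pow, Polynomial.aeval_X, mul_pow, ← mul_assoc, ← pow_add,
    quantize_monomial]

/-- The operator `1 - p ∂ₜ` on `ℂ[t]`. -/
def oneSubDeriv (p : ℂ) : Polynomial ℂ →ₗ[ℂ] Polynomial ℂ :=
  LinearMap.id - p • Polynomial.derivative

theorem oneSubDeriv_apply (p : ℂ) (P : Polynomial ℂ) :
    oneSubDeriv p P = P - p • Polynomial.derivative P := rfl

/-- Both sides are linear in P, so it suffices to compare them on powers t^j, where the term p j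
t^(j-1) of the recursion is p∂_t. -/
theorem adag_mul_quantizeDiag (p : ℂ) (n : ℕ) (P : Polynomial ℂ) :
    adag * quantizeDiag (ordered p) n P = quantizeDiag (ordered p) (n + 1) (oneSubDeriv p P) := by
  have h : LinearMap.mulLeft ℂ adag ∘ₗ quantizeDiag (ordered p) n =
      quantizeDiag (ordered p) (n + 1) ∘ₗ oneSubDeriv p := by
    refine (Polynomial.basisMonomials ℂ).ext fun j => ?_
    simp only [Polynomial.coe_basisMonomials, Polynomial.monomial_one_right_eq_X_pow,
      LinearMap.comp_apply, LinearMap.mulLeft_apply, oneSubDeriv_apply, map_sub, map_smul,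
      quantizeDiag_X_pow, adag_mul_ordered, Polynomial.derivative_X_pow]
    rw [← Polynomial.smul_eq_C_mul, map_smul, quantizeDiag_X_pow, smul_smul,
      add_right_comm n 1 j]
    rcases j with _ | j
    · simp
    · rw [Nat.add_sub_cancel, add_assoc n 1 j, add_comm 1 j]
  exact LinearMap.congr_fun h P

theorem adag_pow_mul_quantizeDiag (p : ℂ) (n m : ℕ) (P : Polynomial ℂ) :
    adag ^ m * quantizeDiag (ordered p) n P =
      quantizeDiag (ordered p) (n + m) ((oneSubDeriv p)^[m] P) := by
  induction m with
  | zero => simp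
  | succ m ih =>
    rw [pow_succ', mul_assoc, ih, adag_mul_quantizeDiag, Function.iterate_succ_apply', add_assoc]

/-- On t^j the factor (1-p)(n+1+j) appears, with j read as t∂_t. The index n + 1 ensures that a
power of α* is available to be lowered. -/
theorem a_mul_quantizeDiag (p : ℂ) (n : ℕ) (P : Polynomial ℂ) :
    a * quantizeDiag (ordered p) (n + 1) P = quantizeDiag (ordered p) n (Polynomial.X * P +
      (1 - p) • ((n + 1 : ℂ) • P + Polynomial.X * Polynomial.derivative P)) := by
  let T : Polynomial ℂ →ₗ[ℂ] Polynomial ℂ := LinearMap.mulLeft ℂ Polynomial.X +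
    (1 - p) • ((n + 1 : ℂ) • LinearMap.id +
      LinearMap.mulLeft ℂ Polynomial.X ∘ₗ Polynomial.derivative)
  have hT (Q : Polynomial ℂ) : T Q = Polynomial.X * Q +
      (1 - p) • ((n + 1 : ℂ) • Q + Polynomial.X * Polynomial.derivative Q) := rfl
  have h : LinearMap.mulLeft ℂ a ∘ₗ quantizeDiag (ordered p) (n + 1) =
      quantizeDiag (ordered p) n ∘ₗ T := by
    refine (Polynomial.basisMonomials ℂ).ext fun j => ?_
    have hX : (Polynomial.X : Polynomial ℂ) * Polynomial.derivative (Polynomial.X ^ j) =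
        (j : ℂ) • Polynomial.X ^ j := by
      rw [Polynomial.derivative_X_pow, ← Polynomial.smul_eq_C_mul, mul_smul_comm]
      rcases j with _ | j
      · simp
      · rw [Nat.add_sub_cancel, ← pow_succ']
    simp only [Polynomial.coe_basisMonomials, Polynomial.monomial_one_right_eq_X_pow,
      LinearMap.comp_apply, LinearMap.mulLeft_apply, hT, hX, map_add, map_smul, ← pow_succ',
      quantizeDiag_X_pow, a_mul_ordered]
    rw [show n + 1 + j - 1 = n + j by omega, show n + 1 + j = n + (j + 1) by omega]
    push_cast
    module
  exact LinearMap.congr_fun h P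

/-! ### Coefficients of exponential series -/

theorem coeff_pow_eq_zero_of_lt {S : Type*} [CommRing S] {u : S⟦X⟧}
    (hu : PowerSeries.constantCoeff u = 0) {j k : ℕ} (h : k < j) (v : S⟦X⟧) :
    PowerSeries.coeff k (v * u ^ j) = 0 := by
  obtain ⟨w, rfl⟩ := PowerSeries.X_dvd_iff.mpr hu
  rw [mul_pow, mul_left_comm, PowerSeries.coeff_X_pow_mul', if_neg (by omega)]

theorem coeff_exp_subst {S : Type*} [CommRing S] [Algebra ℂ S] {u : S⟦X⟧}
    (hu : PowerSeries.constantCoeff u = 0) (k : ℕ) :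
    PowerSeries.coeff k ((PowerSeries.exp ℂ).subst u) =
      ∑ j ∈ Finset.range (k + 1), ((j.factorial : ℂ)⁻¹) • PowerSeries.coeff k (u ^ j) := by
  rw [PowerSeries.coeff_subst' (PowerSeries.HasSubst.of_constantCoeff_zero' hu),
    finsum_eq_sum_of_support_subset (s := Finset.range (k + 1))]
  · refine Finset.sum_congr rfl fun j _ => ?_
    rw [PowerSeries.coeff_exp]
    simp
  · intro j hj
    rw [Finset.coe_range, Set.mem_Iio]
    by_contra hlt
    apply hj
    have h0 := coeff_pow_eq_zero_of_lt hu (by omega : k < j) 1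
    rw [one_mul] at h0
    beta_reduce
    rw [h0, smul_zero]

/-- This reduces identities in ℂ[t][[z]] to identities between the one-variable series d h^j. -/
theorem coeff_coeff_riordanEGF {h : ℂ⟦X⟧} (hh : PowerSeries.constantCoeff h = 0) (d : ℂ⟦X⟧)
    (j k : ℕ) : (PowerSeries.coeff k (riordanEGF d h)).coeff j =
      (j.factorial : ℂ)⁻¹ * PowerSeries.coeff k (d * h ^ j) := by
  have hu : PowerSeries.constantCoeff
      (PowerSeries.C (Polynomial.X : Polynomial ℂ) * PowerSeries.map Polynomial.C h) = 0 := by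
    rw [map_mul, ← PowerSeries.coeff_zero_eq_constantCoeff_apply (PowerSeries.map _ _),
      PowerSeries.coeff_map, PowerSeries.coeff_zero_eq_constantCoeff_apply, hh, map_zero, mul_zero]
  have hsum (l : ℕ) (hl : l ≤ k) :
      (PowerSeries.coeff l ((PowerSeries.exp ℂ).subst
        (PowerSeries.C (Polynomial.X : Polynomial ℂ) * PowerSeries.map Polynomial.C h))).coeff j =
      (j.factorial : ℂ)⁻¹ * PowerSeries.coeff l (h ^ j) := by
    rw [coeff_exp_subst hu, Polynomial.finsetSum_coeff]
    have hterm (i : ℕ) : (((i.factorial : ℂ)⁻¹) • PowerSeries.coeff l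
        ((PowerSeries.C (Polynomial.X : Polynomial ℂ) * PowerSeries.map Polynomial.C h) ^ i)).coeff
          j = if i = j then (j.factorial : ℂ)⁻¹ * PowerSeries.coeff l (h ^ j) else 0 := by
      rw [mul_pow, ← map_pow, ← map_pow, PowerSeries.coeff_C_mul, PowerSeries.coeff_map,
        Polynomial.coeff_smul, Polynomial.coeff_mul_C, Polynomial.coeff_X_pow]
      split_ifs with h1 h2 h2 <;> simp_all
    simp_rw [hterm]
    rw [Finset.sum_ite_eq']
    split_ifs with hj
    · rfl
    -- Here j lies beyond the truncated sum, and h^j has order at least j.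
    · rw [← one_mul (h ^ j), coeff_pow_eq_zero_of_lt hh (by simpa using hj), mul_zero]
  rw [riordanEGF, PowerSeries.coeff_mul, Polynomial.finsetSum_coeff, PowerSeries.coeff_mul,
    Finset.mul_sum]
  refine Finset.sum_congr rfl fun x hx => ?_
  have hx := Finset.HasAntidiagonal.mem_antidiagonal.mp hx
  rw [PowerSeries.coeff_map, Polynomial.coeff_C_mul, hsum _ (by omega)]
  ring

theorem derivative_coeff_riordanEGF {h : ℂ⟦X⟧} (hh : PowerSeries.constantCoeff h = 0) (d : ℂ⟦X⟧)
    (k : ℕ) : Polynomial.derivative (PowerSeries.coeff k (riordanEGF d h)) =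
      PowerSeries.coeff k (riordanEGF (d * h) h) := by
  ext j
  rw [Polynomial.coeff_derivative, coeff_coeff_riordanEGF hh, coeff_coeff_riordanEGF hh, pow_succ',
    mul_assoc d, Nat.factorial_succ]
  have : (j : ℂ) + 1 ≠ 0 := by exact_mod_cast j.succ_ne_zero
  have : (j.factorial : ℂ) ≠ 0 := by exact_mod_cast j.factorial_ne_zero
  push_cast
  field_simp

/-- Since ∂_t e^(th) = h e^(th), the operator 1 - p∂_t multiplies d by 1 - ph. -/
theorem oneSubDeriv_coeff_riordanEGF (p : ℂ) {h : ℂ⟦X⟧} (hh : PowerSeries.constantCoeff h = 0)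
    (d : ℂ⟦X⟧) (k : ℕ) : oneSubDeriv p (PowerSeries.coeff k (riordanEGF d h)) =
      PowerSeries.coeff k (riordanEGF ((1 - PowerSeries.C p * h) * d) h) := by
  rw [oneSubDeriv_apply, derivative_coeff_riordanEGF hh]
  ext j
  rw [Polynomial.coeff_sub, Polynomial.coeff_smul, coeff_coeff_riordanEGF hh,
    coeff_coeff_riordanEGF hh, coeff_coeff_riordanEGF hh, show (1 - PowerSeries.C p * h) * d * h ^ j
      = d * h ^ j - PowerSeries.C p * (d * h * h ^ j) by ring, map_sub, PowerSeries.coeff_C_mul,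
    smul_eq_mul]
  ring

theorem oneSubDeriv_iterate_coeff_riordanEGF (p : ℂ) {h : ℂ⟦X⟧}
    (hh : PowerSeries.constantCoeff h = 0) (d : ℂ⟦X⟧) (k m : ℕ) :
    (oneSubDeriv p)^[m] (PowerSeries.coeff k (riordanEGF d h)) =
      PowerSeries.coeff k (riordanEGF ((1 - PowerSeries.C p * h) ^ m * d) h) := by
  induction m with
  | zero => simp
  | succ m ih =>
    rw [Function.iterate_succ_apply', ih, oneSubDeriv_coeff_riordanEGF p hh, pow_succ', mul_assoc]

/-! ### The evolution equation -/

/-- With a moved to the far left, all creators act first, so a always meets a positive power of α*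
and `a_mul_quantizeDiag` applies. -/
theorem adag_pow_mul_a_mul_adag_pow {L R e : ℕ} (he : L + R = e + 1) :
    adag ^ L * a * adag ^ R = a * adag ^ (e + 1) - (L : ℂ) • adag ^ e := by
  have h := a_mul_adag_pow L
  rw [← he, pow_add, ← mul_assoc, h, add_mul, smul_mul_assoc]
  rcases L with _ | L
  · simp
  · rw [Nat.add_sub_cancel, ← pow_add, show L + R = e by omega, add_sub_cancel_right]

/-- The coefficients of `d(λ α*ᵉ) exp (α* α h(λ α*ᵉ))` satisfy the recursion of `exp (λ G)` as soon
as `d` and `h` satisfy the corresponding differential equations. -/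
theorem generator_mul_quantizeDiag {L R e : ℕ} (he : L + R = e + 1) (p : ℂ) {d h : ℂ⟦X⟧}
    (hh : PowerSeries.constantCoeff h = 0)
    (hA : PowerSeries.derivative ℂ h = (1 - PowerSeries.C p * h) ^ (e + 1) *
      (1 + PowerSeries.C (1 - p) * h +
        PowerSeries.C ((1 - p) * e) * PowerSeries.X * PowerSeries.derivative ℂ h))
    (hB : PowerSeries.derivative ℂ d =
      PowerSeries.C ((1 - p) * (e + 1)) * ((1 - PowerSeries.C p * h) ^ (e + 1) * d) +
      PowerSeries.C ((1 - p) * e) * PowerSeries.X *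
        PowerSeries.derivative ℂ ((1 - PowerSeries.C p * h) ^ (e + 1) * d) -
      PowerSeries.C (L : ℂ) * ((1 - PowerSeries.C p * h) ^ e * d)) (k : ℕ) :
    adag ^ L * a * adag ^ R *
        quantizeDiag (ordered p) (e * k) (PowerSeries.coeff k (riordanEGF d h)) =
      ((k + 1 : ℂ)) • quantizeDiag (ordered p) (e * (k + 1))
        (PowerSeries.coeff (k + 1) (riordanEGF d h)) := by
  rw [adag_pow_mul_a_mul_adag_pow he, sub_mul, mul_assoc, adag_pow_mul_quantizeDiag,
    ← add_assoc, a_mul_quantizeDiag, smul_mul_assoc, adag_pow_mul_quantizeDiag, ← map_smul,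
    ← map_sub, ← map_smul, oneSubDeriv_iterate_coeff_riordanEGF p hh,
    oneSubDeriv_iterate_coeff_riordanEGF p hh, mul_add e k 1, mul_one]
  congr 1
  set D := (1 - PowerSeries.C p * h) ^ (e + 1) * d with hD
  set D' := (1 - PowerSeries.C p * h) ^ e * d with hD'
  -- The factor k in the exponent ek of α* becomes the operator z∂_z.
  have hXD (k : ℕ) (F : ℂ⟦X⟧) :
      PowerSeries.coeff k (PowerSeries.X * PowerSeries.derivative ℂ F) =
        k * PowerSeries.coeff k F := by
    rcases k with _ | k
    · simp
    · rw [PowerSeries.coeff_succ_X_mul, PowerSeries.coeff_derivative]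
      push_cast
      ring
  ext j
  have hk (F : ℂ⟦X⟧) : ((k : ℂ) + 1) * PowerSeries.coeff (k + 1) F =
      PowerSeries.coeff k (PowerSeries.derivative ℂ F) := by
    rw [PowerSeries.coeff_derivative, mul_comm]
  simp only [Polynomial.coeff_sub, Polynomial.coeff_add, Polynomial.coeff_smul, smul_eq_mul]
  rw [coeff_coeff_riordanEGF hh, coeff_coeff_riordanEGF hh, coeff_coeff_riordanEGF hh,
    mul_left_comm _ _ (PowerSeries.coeff (k + 1) _), hk]
  -- The t^0 part is exactly `hB`. Higher powers of t combine `hB` and `hA` through the Leibniz rule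
  -- for d h^(j+1).
  rcases j with _ | j
  · have h1 := congrArg (PowerSeries.coeff k) hB
    rw [map_sub, map_add, mul_assoc, PowerSeries.coeff_C_mul, PowerSeries.coeff_C_mul, hXD,
      PowerSeries.coeff_C_mul] at h1
    simp only [Polynomial.coeff_X_mul_zero, pow_zero, mul_one]
    rw [h1]
    push_cast
    simp only [Nat.factorial_zero, Nat.cast_one, inv_one]
    ring
  · rw [Polynomial.coeff_X_mul, Polynomial.coeff_X_mul, Polynomial.coeff_derivative,
      coeff_coeff_riordanEGF hh, coeff_coeff_riordanEGF hh]
    have hkey : PowerSeries.derivative ℂ (d * h ^ (j + 1)) =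
        PowerSeries.C ((1 - p) * (e + 1)) * (D * h ^ (j + 1)) +
        PowerSeries.C ((1 - p) * e) *
          (PowerSeries.X * PowerSeries.derivative ℂ (D * h ^ (j + 1))) +
        PowerSeries.C ((1 - p) * (j + 1)) * (D * h ^ (j + 1)) +
        PowerSeries.C ((j + 1 : ℕ) : ℂ) * (D * h ^ j) -
        PowerSeries.C (L : ℂ) * (D' * h ^ (j + 1)) := by
      rw [Derivation.leibniz, Derivation.leibniz, PowerSeries.derivative_pow]
      simp only [smul_eq_mul, Nat.add_sub_cancel, map_mul, map_add, map_natCast, map_one,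
        Nat.cast_add, Nat.cast_one] at hA hB ⊢
      linear_combination h ^ (j + 1) * hB + (j + 1) * d * h ^ j * hA - (j + 1) * h ^ j *
        (1 + PowerSeries.C (1 - p) * h + PowerSeries.C (1 - p) * e * PowerSeries.X *
          PowerSeries.derivative ℂ h) * hD
    have h1 := congrArg (PowerSeries.coeff k) hkey
    simp only [map_sub, map_add, PowerSeries.coeff_C_mul, hXD] at h1
    rw [h1, Nat.factorial_succ]
    have : (j : ℂ) + 1 ≠ 0 := by exact_mod_cast j.succ_ne_zero
    have : (j.factorial : ℂ) ≠ 0 := by exact_mod_cast j.factorial_ne_zero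
    push_cast
    field_simp
    ring

/-! ### Binomial powers, logarithms and exponentials -/

theorem derivative_C_mul (b : ℂ) (F : ℂ⟦X⟧) : PowerSeries.derivative ℂ (PowerSeries.C b * F) =
    PowerSeries.C b * PowerSeries.derivative ℂ F := by
  rw [Derivation.leibniz, PowerSeries.derivative_C, smul_zero, add_zero, smul_eq_mul]

theorem derivative_pow_mul_self (F : ℂ⟦X⟧) (n : ℕ) : F * PowerSeries.derivative ℂ (F ^ n) =
    PowerSeries.C (n : ℂ) * F ^ n * PowerSeries.derivative ℂ F := by
  rw [PowerSeries.derivative_pow]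
  rcases n with _ | n
  · simp
  · rw [Nat.add_sub_cancel, map_natCast]
    ring

theorem derivative_binomialSeries (c : ℂ) : (1 + PowerSeries.X) *
    PowerSeries.derivative ℂ (PowerSeries.binomialSeries ℂ c) =
      PowerSeries.C c * PowerSeries.binomialSeries ℂ c := by
  ext n
  have h (n : ℕ) : Ring.choose c (n + 1) * (n + 1) = Ring.choose c n * (c - n) := by
    have h1 := Ring.choose_smul_choose c (Nat.le_succ n)
    rw [Nat.choose_succ_self_right, Nat.succ_eq_add_one, Nat.add_sub_cancel_left,
      Ring.choose_one_right, nsmul_eq_mul] at h1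
    rw [← h1]
    push_cast
    ring
  rw [add_mul, one_mul, map_add, PowerSeries.coeff_derivative, PowerSeries.coeff_C_mul,
    PowerSeries.binomialSeries_coeff, PowerSeries.binomialSeries_coeff, smul_eq_mul, smul_eq_mul,
    mul_one, mul_one, h]
  rcases n with _ | n
  · simp
  · rw [PowerSeries.coeff_succ_X_mul, PowerSeries.coeff_derivative,
      PowerSeries.binomialSeries_coeff, smul_eq_mul, mul_one]
    push_cast
    ring

theorem derivative_log : (1 + PowerSeries.X) * PowerSeries.derivative ℂ (PowerSeries.log ℂ) = 1 := by
  rw [PowerSeries.deriv_log]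
  ext n
  rcases n with _ | n
  · simp
  · rw [add_mul, one_mul, map_add, PowerSeries.coeff_succ_X_mul, PowerSeries.coeff_one]
    simp [pow_succ]

theorem constantCoeff_subst_eq {u : ℂ⟦X⟧} (hu : PowerSeries.constantCoeff u = 0) (f : ℂ⟦X⟧) :
    PowerSeries.constantCoeff (f.subst u) = PowerSeries.constantCoeff f := by
  have hs := PowerSeries.HasSubst.of_constantCoeff_zero' hu
  have h : f = (f - PowerSeries.C (PowerSeries.constantCoeff f)) +
    PowerSeries.C (PowerSeries.constantCoeff f) := by ring
  conv_lhs => rw [h]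
  rw [PowerSeries.subst_add hs, map_add, PowerSeries.subst_C]
  erw [PowerSeries.constantCoeff_subst_eq_zero hu _ (by simp)]
  rw [zero_add]
  exact PowerSeries.constantCoeff_C _

section

variable {u : ℂ⟦X⟧}

theorem constantCoeff_onePlusPow (hu : PowerSeries.constantCoeff u = 0) (c : ℂ) :
    PowerSeries.constantCoeff (onePlusPow u c) = 1 := by
  rw [onePlusPow, constantCoeff_subst_eq hu, PowerSeries.binomialSeries_constantCoeff]

theorem constantCoeff_expSeries (hu : PowerSeries.constantCoeff u = 0) :
    PowerSeries.constantCoeff (expSeries u) = 1 := by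
  rw [expSeries, constantCoeff_subst_eq hu, PowerSeries.constantCoeff_exp]

theorem subst_one_add_X (hu : PowerSeries.constantCoeff u = 0) :
    (1 + PowerSeries.X : ℂ⟦X⟧).subst u = 1 + u := by
  have hs := PowerSeries.HasSubst.of_constantCoeff_zero' hu
  rw [← PowerSeries.coe_substAlgHom hs, map_add, map_one, PowerSeries.coe_substAlgHom hs,
    PowerSeries.subst_X hs]

theorem onePlusPow_natCast (hu : PowerSeries.constantCoeff u = 0) (n : ℕ) :
    onePlusPow u n = (1 + u) ^ n := by
  have hs := PowerSeries.HasSubst.of_constantCoeff_zero' hu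
  rw [onePlusPow, PowerSeries.binomialSeries_nat, PowerSeries.subst_pow hs, subst_one_add_X hu]

theorem onePlusPow_neg_natCast_mul (hu : PowerSeries.constantCoeff u = 0) (n : ℕ) :
    onePlusPow u (-n) * (1 + u) ^ n = 1 := by
  have hs := PowerSeries.HasSubst.of_constantCoeff_zero' hu
  rw [← onePlusPow_natCast hu, onePlusPow, onePlusPow, ← PowerSeries.subst_mul hs,
    ← PowerSeries.binomialSeries_add, neg_add_cancel, PowerSeries.binomialSeries_zero,
    ← PowerSeries.coe_substAlgHom hs, map_one]

theorem derivative_onePlusPow (hu : PowerSeries.constantCoeff u = 0) (c : ℂ) :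
    (1 + u) * PowerSeries.derivative ℂ (onePlusPow u c) =
      PowerSeries.C c * PowerSeries.derivative ℂ u * onePlusPow u c := by
  have hs := PowerSeries.HasSubst.of_constantCoeff_zero' hu
  have h := congrArg (PowerSeries.subst u) (derivative_binomialSeries c)
  rw [PowerSeries.subst_mul hs, PowerSeries.subst_mul hs, subst_one_add_X hu,
    PowerSeries.subst_C] at h
  rw [onePlusPow, PowerSeries.derivative_subst hs, ← mul_assoc, h]
  exact mul_right_comm _ _ _

theorem derivative_logOnePlus (hu : PowerSeries.constantCoeff u = 0) :
    (1 + u) * PowerSeries.derivative ℂ (logOnePlus u) = PowerSeries.derivative ℂ u := by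
  have hs := PowerSeries.HasSubst.of_constantCoeff_zero' hu
  have h := congrArg (PowerSeries.subst u) derivative_log
  rw [PowerSeries.subst_mul hs, subst_one_add_X hu, ← PowerSeries.coe_substAlgHom hs, map_one,
    PowerSeries.coe_substAlgHom hs] at h
  rw [logOnePlus, PowerSeries.derivative_subst hs, ← mul_assoc, h, one_mul]

theorem derivative_expSeries (hu : PowerSeries.constantCoeff u = 0) :
    PowerSeries.derivative ℂ (expSeries u) = PowerSeries.derivative ℂ u * expSeries u := by
  rw [expSeries, PowerSeries.derivative_subst (PowerSeries.HasSubst.of_constantCoeff_zero' hu),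
    PowerSeries.derivative_exp, mul_comm]

/-- This equation has the same form for e = 0 and e > 0, so later arguments need no separate limit.
-/
theorem derivative_stridePow (e : ℕ) (hu : PowerSeries.constantCoeff u = 0) (c : ℂ) :
    (1 + PowerSeries.C (e : ℂ) * u) * PowerSeries.derivative ℂ (stridePow e u c) =
      PowerSeries.C c * PowerSeries.derivative ℂ u * stridePow e u c := by
  have hb (b : ℂ) : PowerSeries.constantCoeff (PowerSeries.C b * u) = 0 := by simp [hu]
  rw [stridePow]
  split_ifs with he
  · rw [derivative_expSeries (hb c), derivative_C_mul, he]
    simp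
  · have he' : (e : ℂ) ≠ 0 := by exact_mod_cast he
    rw [derivative_onePlusPow (hb _), derivative_C_mul, ← mul_assoc, ← map_mul, div_mul_cancel₀ c he']

theorem constantCoeff_stridePow (e : ℕ) (hu : PowerSeries.constantCoeff u = 0) (c : ℂ) :
    PowerSeries.constantCoeff (stridePow e u c) = 1 := by
  rw [stridePow]
  split_ifs with he
  · exact constantCoeff_expSeries (by simp [hu])
  · exact constantCoeff_onePlusPow (by simp [hu]) _

end

/-- Uniqueness for the linear differential equation `v y' = w y`. -/
theorem eq_of_linear_ode {v w y z : ℂ⟦X⟧} (hv : PowerSeries.constantCoeff v = 1)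
    (hy : v * PowerSeries.derivative ℂ y = w * y) (hz : v * PowerSeries.derivative ℂ z = w * z)
    (hy0 : PowerSeries.constantCoeff y = 1) (hz0 : PowerSeries.constantCoeff z = 1) : y = z := by
  have hv0 : v ≠ 0 := fun h => by simp [h] at hv
  have hz1 : PowerSeries.constantCoeff z ≠ 0 := by simp [hz0]
  have hz2 : z⁻¹ * z = 1 := PowerSeries.inv_mul_cancel z hz1
  -- The quotient y/z has zero derivative and constant term 1.
  have h : y * z⁻¹ = 1 := by
    apply PowerSeries.derivative.ext
    · rw [PowerSeries.derivative_one, Derivation.leibniz, PowerSeries.derivative_inv', smul_eq_mul,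
        smul_eq_mul]
      apply mul_left_cancel₀ hv0
      linear_combination z⁻¹ * hy - y * z⁻¹ ^ 2 * hz - y * z⁻¹ * w * hz2
    · simp [hy0, hz0]
  linear_combination z * h - y * hz2

theorem eq_stridePow {u : ℂ⟦X⟧} {e : ℕ} (hu : PowerSeries.constantCoeff u = 0) {c : ℂ} {y : ℂ⟦X⟧}
    (hy : (1 + PowerSeries.C (e : ℂ) * u) * PowerSeries.derivative ℂ y =
      PowerSeries.C c * PowerSeries.derivative ℂ u * y)
    (hy0 : PowerSeries.constantCoeff y = 1) : y = stridePow e u c :=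
  eq_of_linear_ode (by simp [hu]) hy (derivative_stridePow e hu c) hy0
    (constantCoeff_stridePow e hu c)

/-! ### Algebraic relations for `f_T` and `g_T` -/

theorem gT_mul (L R : ℕ) (s : ℂ) : gT 1 (-L) R s *
    ((1 - PowerSeries.C ((1 + s) / 2) * PowerSeries.X) ^ L *
      (1 + PowerSeries.C ((1 - s) / 2) * PowerSeries.X) ^ R) =
    PowerSeries.C ((1 + s) / 2) * (1 + PowerSeries.C ((1 - s) / 2) * PowerSeries.X) ^ (L + R) +
    PowerSeries.C ((1 - s) / 2) * (1 - PowerSeries.C ((1 + s) / 2) * PowerSeries.X) ^ (L + R) := by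
  have h1 : -(-(L : ℂ)) / 1 = L := by ring
  simp only [gT, if_neg one_ne_zero, mul_one, h1, div_one]
  set P : ℂ⟦X⟧ := 1 - PowerSeries.C ((1 + s) / 2) * PowerSeries.X with hP
  set Q : ℂ⟦X⟧ := 1 + PowerSeries.C ((1 - s) / 2) * PowerSeries.X with hQ
  have hP0 : PowerSeries.constantCoeff P = 1 := by simp [hP]
  have hQ0 : PowerSeries.constantCoeff Q = 1 := by simp [hQ]
  have hPi : P⁻¹ * P = 1 := PowerSeries.inv_mul_cancel P (by simp [hP0])
  have hQi : Q⁻¹ * Q = 1 := PowerSeries.inv_mul_cancel Q (by simp [hQ0])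
  rw [onePlusPow_natCast (by simp [hP0, hQ0]), onePlusPow_natCast (by simp [hP0, hQ0]),
    add_sub_cancel, add_sub_cancel, mul_pow, mul_pow]
  have hPL : P⁻¹ ^ L * P ^ L = 1 := by rw [← mul_pow, hPi, one_pow]
  have hQR : Q⁻¹ ^ R * Q ^ R = 1 := by rw [← mul_pow, hQi, one_pow]
  linear_combination PowerSeries.C ((1 + s) / 2) * Q ^ (L + R) * hPL +
    PowerSeries.C ((1 - s) / 2) * P ^ (L + R) * hQR

/-- The factor e clears the denominators 1/A. At e = 0 the identity is empty, and the logarithmic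
case enters only through `derivative_fT_mul`. -/
theorem fT_mul (e : ℕ) (s : ℂ) : PowerSeries.C (e : ℂ) * fT e 1 s *
    ((1 - PowerSeries.C ((1 + s) / 2) * PowerSeries.X) ^ e *
      (1 + PowerSeries.C ((1 - s) / 2) * PowerSeries.X) ^ e) =
    (1 + PowerSeries.C ((1 - s) / 2) * PowerSeries.X) ^ e -
    (1 - PowerSeries.C ((1 + s) / 2) * PowerSeries.X) ^ e := by
  rcases Nat.eq_zero_or_pos e with rfl | he
  · simp
  have he' : (e : ℂ) ≠ 0 := by exact_mod_cast he.ne'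
  simp only [fT, if_neg he', if_neg one_ne_zero, map_one, one_mul, div_one, sub_eq_add_neg (1 : ℂ⟦X⟧)]
  set u : ℂ⟦X⟧ := -(PowerSeries.C ((1 + s) / 2) * PowerSeries.X) with hu
  set v : ℂ⟦X⟧ := PowerSeries.C ((1 - s) / 2) * PowerSeries.X with hv
  have h1 := onePlusPow_neg_natCast_mul (u := u) (by simp [hu]) e
  have h2 := onePlusPow_neg_natCast_mul (u := v) (by simp [hv]) e
  have h3 : PowerSeries.C (e : ℂ) * PowerSeries.C (1 / (e : ℂ)) = (1 : ℂ⟦X⟧) := by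
    rw [← map_mul, mul_one_div_cancel he', map_one]
  have h4 : PowerSeries.C (e : ℂ) * PowerSeries.C (1 / (-(e : ℂ))) = (-1 : ℂ⟦X⟧) := by
    rw [← map_mul, one_div, inv_neg, mul_neg, mul_inv_cancel₀ he', map_neg, map_one]
  linear_combination (1 + u) ^ e * (1 + v) ^ e * ((onePlusPow u (-e) - 1) * h3 +
    (onePlusPow v (-e) - 1) * h4) + (1 + v) ^ e * h1 - (1 + u) ^ e * h2

theorem derivative_fT_mul (e : ℕ) (s : ℂ) : PowerSeries.derivative ℂ (fT e 1 s) *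
    ((1 - PowerSeries.C ((1 + s) / 2) * PowerSeries.X) ^ (e + 1) *
      (1 + PowerSeries.C ((1 - s) / 2) * PowerSeries.X) ^ (e + 1)) =
    PowerSeries.C ((1 + s) / 2) * (1 + PowerSeries.C ((1 - s) / 2) * PowerSeries.X) ^ (e + 1) +
    PowerSeries.C ((1 - s) / 2) *
      (1 - PowerSeries.C ((1 + s) / 2) * PowerSeries.X) ^ (e + 1) := by
  have hd (b : ℂ) : PowerSeries.derivative ℂ (PowerSeries.C b * PowerSeries.X) =
      PowerSeries.C b := by
    rw [derivative_C_mul, PowerSeries.derivative_X, mul_one]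
  rcases Nat.eq_zero_or_pos e with rfl | he
  · simp only [fT, Nat.cast_zero, if_pos, if_neg one_ne_zero, map_one, one_mul, div_one,
      sub_eq_add_neg (1 : ℂ⟦X⟧), zero_add, pow_one]
    set u : ℂ⟦X⟧ := -(PowerSeries.C ((1 + s) / 2) * PowerSeries.X) with hu
    set v : ℂ⟦X⟧ := PowerSeries.C ((1 - s) / 2) * PowerSeries.X with hv
    have h1 := derivative_logOnePlus (u := u) (by simp [hu])
    have h2 := derivative_logOnePlus (u := v) (by simp [hv])
    have h3 : PowerSeries.derivative ℂ u = -PowerSeries.C ((1 + s) / 2) := by rw [hu, map_neg, hd]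
    have h4 : PowerSeries.derivative ℂ v = PowerSeries.C ((1 - s) / 2) := hd _
    rw [map_sub]
    rw [h3] at h1
    rw [h4] at h2
    linear_combination (1 + u) * h2 - (1 + v) * h1
  have he' : (e : ℂ) ≠ 0 := by exact_mod_cast he.ne'
  simp only [fT, if_neg he', if_neg one_ne_zero, map_one, one_mul, div_one,
    sub_eq_add_neg (1 : ℂ⟦X⟧)]
  set u : ℂ⟦X⟧ := -(PowerSeries.C ((1 + s) / 2) * PowerSeries.X) with hu
  set v : ℂ⟦X⟧ := PowerSeries.C ((1 - s) / 2) * PowerSeries.X with hv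
  have h1 := onePlusPow_neg_natCast_mul (u := u) (by simp [hu]) e
  have h2 := onePlusPow_neg_natCast_mul (u := v) (by simp [hv]) e
  have h3 : PowerSeries.derivative ℂ u = -PowerSeries.C ((1 + s) / 2) := by rw [hu, map_neg, hd]
  have h4 : PowerSeries.derivative ℂ v = PowerSeries.C ((1 - s) / 2) := hd _
  have h5 := derivative_onePlusPow (u := u) (by simp [hu]) (-e)
  have h6 := derivative_onePlusPow (u := v) (by simp [hv]) (-e)
  rw [h3] at h5
  rw [h4] at h6
  have h7 : PowerSeries.C (1 / (e : ℂ)) * PowerSeries.C (-(e : ℂ)) = (-1 : ℂ⟦X⟧) := by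
    rw [← map_mul, mul_neg, one_div_mul_cancel he', map_neg, map_one]
  have h8 : PowerSeries.C (1 / (-(e : ℂ))) * PowerSeries.C (-(e : ℂ)) = (1 : ℂ⟦X⟧) := by
    rw [← map_mul, one_div_mul_cancel (neg_ne_zero.mpr he'), map_one]
  rw [map_add, derivative_C_mul, derivative_C_mul, map_sub, map_sub,
    PowerSeries.derivative_one, sub_zero, sub_zero]
  set U := onePlusPow u (-e)
  set V := onePlusPow v (-e)
  set p : ℂ⟦X⟧ := PowerSeries.C ((1 + s) / 2)
  set q : ℂ⟦X⟧ := PowerSeries.C ((1 - s) / 2)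
  linear_combination (1 + u) ^ e * (1 + v) ^ (e + 1) * (PowerSeries.C (1 / (e : ℂ)) * h5 - p * U * h7)
    + (1 + v) ^ (e + 1) * p * h1 +
    (1 + v) ^ e * (1 + u) ^ (e + 1) * (PowerSeries.C (1 / (-(e : ℂ))) * h6 + q * V * h8)
    + (1 + u) ^ (e + 1) * q * h2

/-! ### The inverse pair -/

theorem isUnit_coeff_one_fT (A B s : ℂ) : IsUnit (PowerSeries.coeff 1 (fT A B s)) := by
  rw [coeff_one_fT]
  exact isUnit_one

theorem constantCoeff_fTbar (A B s : ℂ) : PowerSeries.constantCoeff (fTbar A B s) = 0 :=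
  PowerSeries.constantCoeff_substInvOfIsUnit _ (isUnit_coeff_one_fT A B s)

theorem hasSubst_fTbar (A B s : ℂ) : PowerSeries.HasSubst (fTbar A B s) :=
  PowerSeries.HasSubst.of_constantCoeff_zero' (constantCoeff_fTbar A B s)

theorem constantCoeff_fT (e : ℕ) (s : ℂ) : PowerSeries.constantCoeff (fT e 1 s) = 0 := by
  have h1 (u : ℂ⟦X⟧) (hu : PowerSeries.constantCoeff u = 0) :
      PowerSeries.constantCoeff (logOnePlus u) = 0 := by
    rw [logOnePlus, constantCoeff_subst_eq hu, PowerSeries.constantCoeff_log]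
  simp only [fT, if_neg one_ne_zero, map_one, one_mul, div_one]
  split_ifs
  · rw [map_sub, h1 _ (by simp), h1 _ (by simp), sub_zero]
  · rw [map_add, map_mul, map_mul, map_sub, map_sub, constantCoeff_onePlusPow (by simp),
      constantCoeff_onePlusPow (by simp)]
    simp

theorem fT_subst_fTbar (e : ℕ) (s : ℂ) : (fT e 1 s).subst (fTbar e 1 s) = PowerSeries.X :=
  PowerSeries.subst_substInvOfIsUnit_right _ (constantCoeff_fT e s) (isUnit_coeff_one_fT e 1 s)

theorem fTbar_subst_fT (e : ℕ) (s : ℂ) : (fTbar e 1 s).subst (fT e 1 s) = PowerSeries.X :=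
  PowerSeries.subst_substInvOfIsUnit_left _ (constantCoeff_fT e s) (isUnit_coeff_one_fT e 1 s)

theorem constantCoeff_gT (L R : ℕ) (s : ℂ) : PowerSeries.constantCoeff (gT 1 (-L) R s) = 1 := by
  have h := congrArg PowerSeries.constantCoeff (gT_mul L R s)
  simp only [map_mul, map_add, map_sub, map_pow, PowerSeries.constantCoeff_X, map_one,
    PowerSeries.constantCoeff_C, mul_zero, sub_zero, add_zero, one_pow, mul_one] at h
  rw [h]
  ring

theorem gTbar_mul (A s : ℂ) (L R : ℕ) :
    gTbar A 1 (-L) R s * (gT 1 (-L) R s).subst (fTbar A 1 s) = 1 := by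
  apply PowerSeries.inv_mul_cancel
  rw [constantCoeff_subst_eq (constantCoeff_fTbar A 1 s), constantCoeff_gT]
  exact one_ne_zero

theorem constantCoeff_gTbar (A s : ℂ) (L R : ℕ) :
    PowerSeries.constantCoeff (gTbar A 1 (-L) R s) = 1 := by
  have h := congrArg PowerSeries.constantCoeff (gTbar_mul A s L R)
  rwa [map_mul, constantCoeff_subst_eq (constantCoeff_fTbar A 1 s), constantCoeff_gT, mul_one,
    map_one] at h

/-- The first component comes from substituting f_T into ḡ_T · (g_T ∘ f̄_T) = 1. -/
theorem riordanMul_right_inverse (e L R : ℕ) (s : ℂ) :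
    riordanMul (gT 1 (-L) R s, fT e 1 s) (gTbar e 1 (-L) R s, fTbar e 1 s) =
      (1, PowerSeries.X) := by
  have hs := PowerSeries.HasSubst.of_constantCoeff_zero' (constantCoeff_fT e s)
  have h := congrArg (PowerSeries.subst (fT e 1 s)) (gTbar_mul e s L R)
  rw [PowerSeries.subst_mul hs, PowerSeries.subst_comp_subst_apply (hasSubst_fTbar _ _ _) hs,
    fTbar_subst_fT, PowerSeries.X_subst, ← PowerSeries.coe_substAlgHom hs, map_one,
    PowerSeries.coe_substAlgHom hs] at h
  exact Prod.ext h (fTbar_subst_fT e s)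

theorem riordanMul_left_inverse (e L R : ℕ) (s : ℂ) :
    riordanMul (gTbar e 1 (-L) R s, fTbar e 1 s) (gT 1 (-L) R s, fT e 1 s) =
      (1, PowerSeries.X) := by
  refine Prod.ext ?_ (fT_subst_fTbar e s)
  rw [← gTbar_mul e s L R]
  exact mul_comm _ _

theorem subst_linear {h : ℂ⟦X⟧} (hs : PowerSeries.HasSubst h) (c : ℂ) :
    (PowerSeries.C c * PowerSeries.X : ℂ⟦X⟧).subst h = PowerSeries.C c * h := by
  rw [PowerSeries.subst_mul hs, PowerSeries.subst_C, PowerSeries.subst_X hs]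
  rfl

theorem substAlgHom_linear {h : ℂ⟦X⟧} (hs : PowerSeries.HasSubst h) (c : ℂ) :
    PowerSeries.substAlgHom (R := ℂ) hs (PowerSeries.C c * PowerSeries.X) =
      PowerSeries.C c * h := by
  rw [PowerSeries.coe_substAlgHom, subst_linear hs]

theorem substAlgHom_C {h : ℂ⟦X⟧} (hs : PowerSeries.HasSubst h) (c : ℂ) :
    PowerSeries.substAlgHom (R := ℂ) hs (PowerSeries.C c) = PowerSeries.C c := by
  rw [PowerSeries.coe_substAlgHom, PowerSeries.subst_C]
  rfl

/-- The common right-hand side `p (1 + q h)^(e+1) + q (1 - p h)^(e+1)`. -/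
def mixedPow (e : ℕ) (p : ℂ) (h : ℂ⟦X⟧) : ℂ⟦X⟧ :=
  PowerSeries.C p * (1 + PowerSeries.C (1 - p) * h) ^ (e + 1) +
    PowerSeries.C (1 - p) * (1 - PowerSeries.C p * h) ^ (e + 1)

theorem one_sub_half (s : ℂ) : (1 - s) / 2 = 1 - (1 + s) / 2 := by ring

theorem fTbar_relation (e : ℕ) (s : ℂ) :
    PowerSeries.C (e : ℂ) * PowerSeries.X *
      ((1 - PowerSeries.C ((1 + s) / 2) * fTbar e 1 s) ^ e *
        (1 + PowerSeries.C (1 - (1 + s) / 2) * fTbar e 1 s) ^ e) =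
      (1 + PowerSeries.C (1 - (1 + s) / 2) * fTbar e 1 s) ^ e -
        (1 - PowerSeries.C ((1 + s) / 2) * fTbar e 1 s) ^ e := by
  have hs := hasSubst_fTbar e 1 s
  have h := congrArg (PowerSeries.substAlgHom (R := ℂ) hs) (fT_mul e s)
  simp only [map_mul, map_sub, map_add, map_pow, map_one, substAlgHom_linear hs,
    substAlgHom_C hs] at h
  simpa only [PowerSeries.coe_substAlgHom, fT_subst_fTbar, one_sub_half] using h

/-- The chain rule for f_T ∘ f̄_T = z, combined with `derivative_fT_mul` evaluated at f̄_T. -/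
theorem derivative_fTbar_mul (e : ℕ) (s : ℂ) :
    PowerSeries.derivative ℂ (fTbar e 1 s) * mixedPow e ((1 + s) / 2) (fTbar e 1 s) =
      (1 - PowerSeries.C ((1 + s) / 2) * fTbar e 1 s) ^ (e + 1) *
        (1 + PowerSeries.C (1 - (1 + s) / 2) * fTbar e 1 s) ^ (e + 1) := by
  have hs := hasSubst_fTbar e 1 s
  have h := congrArg (PowerSeries.substAlgHom (R := ℂ) hs) (derivative_fT_mul e s)
  have h1 := congrArg (PowerSeries.derivative ℂ) (fT_subst_fTbar e s)
  rw [PowerSeries.derivative_subst hs, PowerSeries.derivative_X] at h1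
  simp only [map_mul, map_sub, map_add, map_pow, map_one, substAlgHom_linear hs,
    substAlgHom_C hs] at h
  rw [PowerSeries.coe_substAlgHom, one_sub_half] at h
  rw [mixedPow, ← h]
  linear_combination ((1 - PowerSeries.C ((1 + s) / 2) * fTbar e 1 s) ^ (e + 1) *
    (1 + PowerSeries.C (1 - (1 + s) / 2) * fTbar e 1 s) ^ (e + 1)) * h1

theorem gTbar_mul_mixedPow {L R e : ℕ} (he : L + R = e + 1) (s : ℂ) :
    gTbar e 1 (-L) R s * mixedPow e ((1 + s) / 2) (fTbar e 1 s) =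
      (1 - PowerSeries.C ((1 + s) / 2) * fTbar e 1 s) ^ L *
        (1 + PowerSeries.C (1 - (1 + s) / 2) * fTbar e 1 s) ^ R := by
  have hs := hasSubst_fTbar e 1 s
  have h := congrArg (PowerSeries.substAlgHom (R := ℂ) hs) (gT_mul L R s)
  simp only [map_mul, map_sub, map_add, map_pow, map_one, substAlgHom_linear hs,
    substAlgHom_C hs] at h
  rw [PowerSeries.coe_substAlgHom, one_sub_half, he] at h
  rw [mixedPow, ← h]
  linear_combination ((1 - PowerSeries.C ((1 + s) / 2) * fTbar e 1 s) ^ L *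
    (1 + PowerSeries.C (1 - (1 + s) / 2) * fTbar e 1 s) ^ R) * gTbar_mul e s L R

/-! ### From the algebraic relations to the differential equations for h and d. -/

section Evolution

variable {L R e : ℕ} {p : ℂ} {d h : ℂ⟦X⟧}

theorem mixedPow_ne_zero (hh : PowerSeries.constantCoeff h = 0) : mixedPow e p h ≠ 0 := by
  intro h0
  have := congrArg PowerSeries.constantCoeff h0
  simp [mixedPow, hh] at this

theorem one_add_C_mul_ne_zero (hh : PowerSeries.constantCoeff h = 0) (c : ℂ) :
    1 + PowerSeries.C c * h ≠ 0 := by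
  intro h0
  have := congrArg PowerSeries.constantCoeff h0
  simp [hh] at this

theorem one_sub_C_mul_ne_zero (hh : PowerSeries.constantCoeff h = 0) (c : ℂ) :
    1 - PowerSeries.C c * h ≠ 0 := by
  intro h0
  have := congrArg PowerSeries.constantCoeff h0
  simp [hh] at this

/-- With q = 1-p, P = 1-ph, Q = 1+qh, the identity pQ + qP = 1 gives M = Q^e - qP(Q^e - P^e), which
is Q^e (1 - q e z P^(e+1)) by `h1`. Then `h2` divided by Q^e is the claim. -/
theorem derivative_eq_of_relations (hh : PowerSeries.constantCoeff h = 0)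
    (h1 : PowerSeries.C (e : ℂ) * PowerSeries.X *
      ((1 - PowerSeries.C p * h) ^ e * (1 + PowerSeries.C (1 - p) * h) ^ e) =
      (1 + PowerSeries.C (1 - p) * h) ^ e - (1 - PowerSeries.C p * h) ^ e)
    (h2 : PowerSeries.derivative ℂ h * mixedPow e p h =
      (1 - PowerSeries.C p * h) ^ (e + 1) * (1 + PowerSeries.C (1 - p) * h) ^ (e + 1)) :
    PowerSeries.derivative ℂ h = (1 - PowerSeries.C p * h) ^ (e + 1) *
      (1 + PowerSeries.C (1 - p) * h +
        PowerSeries.C ((1 - p) * e) * PowerSeries.X * PowerSeries.derivative ℂ h) := by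
  apply mul_left_cancel₀ (pow_ne_zero e (one_add_C_mul_ne_zero hh (1 - p)))
  rw [mixedPow] at h2
  simp only [map_sub, map_one, map_mul] at h1 h2 ⊢
  linear_combination h2 - (1 - PowerSeries.C p) * (1 - PowerSeries.C p * h) *
    PowerSeries.derivative ℂ h * h1

theorem derivative_eq_of_relations' (he : L + R = e + 1) (hh : PowerSeries.constantCoeff h = 0)
    (hA : PowerSeries.derivative ℂ h = (1 - PowerSeries.C p * h) ^ (e + 1) *
      (1 + PowerSeries.C (1 - p) * h +
        PowerSeries.C ((1 - p) * e) * PowerSeries.X * PowerSeries.derivative ℂ h))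
    (h2 : PowerSeries.derivative ℂ h * mixedPow e p h =
      (1 - PowerSeries.C p * h) ^ (e + 1) * (1 + PowerSeries.C (1 - p) * h) ^ (e + 1))
    (h3 : d * mixedPow e p h =
      (1 - PowerSeries.C p * h) ^ L * (1 + PowerSeries.C (1 - p) * h) ^ R) :
    PowerSeries.derivative ℂ d =
      PowerSeries.C ((1 - p) * (e + 1)) * ((1 - PowerSeries.C p * h) ^ (e + 1) * d) +
      PowerSeries.C ((1 - p) * e) * PowerSeries.X *
        PowerSeries.derivative ℂ ((1 - PowerSeries.C p * h) ^ (e + 1) * d) -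
      PowerSeries.C (L : ℂ) * ((1 - PowerSeries.C p * h) ^ e * d) := by
  have hP0 := one_sub_C_mul_ne_zero hh p
  have hQ0 := one_add_C_mul_ne_zero hh (1 - p)
  have hPQ : PowerSeries.C p * (1 + PowerSeries.C (1 - p) * h) +
      PowerSeries.C (1 - p) * (1 - PowerSeries.C p * h) = 1 := by
    simp only [map_sub, map_one]
    ring
  have hP' : PowerSeries.derivative ℂ (1 - PowerSeries.C p * h) =
      -(PowerSeries.C p * PowerSeries.derivative ℂ h) := by
    rw [map_sub, derivative_C_mul, PowerSeries.derivative_one, zero_sub]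
  have hQ' : PowerSeries.derivative ℂ (1 + PowerSeries.C (1 - p) * h) =
      PowerSeries.C (1 - p) * PowerSeries.derivative ℂ h := by
    rw [map_add, derivative_C_mul, PowerSeries.derivative_one, zero_add]
  have hM := mixedPow_ne_zero (e := e) (p := p) hh
  -- From here on P and Q are atoms, linked by pQ + qP = 1, P' = -p h' and Q' = q h'.
  generalize hP : 1 - PowerSeries.C p * h = P at *
  generalize hQ : 1 + PowerSeries.C (1 - p) * h = Q at *
  have hd : d * P ^ R * Q ^ L = PowerSeries.derivative ℂ h := by
    apply mul_right_cancel₀ hM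
    rw [h2, mul_assoc d, mul_assoc d, mul_comm (P ^ R * Q ^ L), ← mul_assoc, h3, ← he]
    ring
  -- K collects the terms of the goal lying under a derivative. By `hd` and `hA` it equals P^L
  -- Q^(1-L), so K' = h' P^(L-1) Q^(-L) (qP - L), which is d P^e (qP - L).
  obtain ⟨K, hK⟩ : ∃ K : ℂ⟦X⟧, K = d * (1 - PowerSeries.C ((1 - p) * e) * PowerSeries.X *
    P ^ (e + 1)) := ⟨_, rfl⟩
  have hKQ : K * Q ^ L = P ^ L * Q := by
    apply mul_left_cancel₀ (pow_ne_zero R hP0)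
    rw [hK, ← mul_assoc (P ^ R) (P ^ L), ← pow_add, add_comm R L, he]
    linear_combination (1 - PowerSeries.C ((1 - p) * e) * PowerSeries.X * P ^ (e + 1)) * hd + hA
  have hK' : PowerSeries.derivative ℂ K =
      d * (PowerSeries.C (1 - p) * P ^ (e + 1) - PowerSeries.C (L : ℂ) * P ^ e) := by
    have h4 := congrArg (PowerSeries.derivative ℂ) hKQ
    rw [Derivation.leibniz, Derivation.leibniz] at h4
    simp only [smul_eq_mul] at h4
    apply mul_left_cancel₀ (mul_ne_zero hP0 (mul_ne_zero hQ0 (pow_ne_zero L hQ0)))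
    have h5 := derivative_pow_mul_self Q L
    have h6 := derivative_pow_mul_self P L
    rw [hP'] at h6
    rw [hQ'] at h4 h5
    have hPe : P ^ (e + 1) = P ^ L * P ^ R := by rw [← he, pow_add]
    linear_combination P * Q * h4 - P * K * h5 + Q ^ 2 * h6 -
      P * PowerSeries.C (L : ℂ) * PowerSeries.C (1 - p) * PowerSeries.derivative ℂ h * hKQ -
      PowerSeries.C (L : ℂ) * PowerSeries.derivative ℂ h * P ^ L * Q * hPQ -
      P ^ L * Q * (P * PowerSeries.C (1 - p) - PowerSeries.C (L : ℂ)) * hd -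
      d * Q * Q ^ L * (P * PowerSeries.C (1 - p) - PowerSeries.C (L : ℂ)) * hPe
  -- Splitting q(e+1) as qe + q, the qe part is absorbed by the derivative of z P^(e+1) d.
  have h7 : PowerSeries.derivative ℂ K = PowerSeries.derivative ℂ d -
      PowerSeries.C ((1 - p) * e) * (P ^ (e + 1) * d + PowerSeries.X *
        PowerSeries.derivative ℂ (P ^ (e + 1) * d)) := by
    rw [hK, show d * (1 - PowerSeries.C ((1 - p) * e) * PowerSeries.X * P ^ (e + 1)) =
      d - PowerSeries.C ((1 - p) * e) * (PowerSeries.X * (P ^ (e + 1) * d)) by ring, map_sub,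
      derivative_C_mul,
      Derivation.leibniz _ PowerSeries.X, PowerSeries.derivative_X]
    simp only [smul_eq_mul]
    ring
  rw [hK'] at h7
  simp only [map_sub, map_mul, map_add, map_one] at h7 ⊢
  linear_combination -h7

end Evolution

/-! ### Substitution of `(t, z) = (α* α, λ α*ᵉ)` -/

theorem coeff_substTZ (e : ℕ) (F : (Polynomial ℂ)⟦X⟧) (k : ℕ) :
    PowerSeries.coeff k (substTZ e F) =
      als ^ (e * k) * Polynomial.aeval (als * al) (PowerSeries.coeff k F) := by
  rw [substTZ, PowerSeries.coeff_rescale, PowerSeries.coeff_map, ← pow_mul]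
  rfl

theorem substTZ_mul (e : ℕ) (F G : (Polynomial ℂ)⟦X⟧) :
    substTZ e (F * G) = substTZ e F * substTZ e G := by
  rw [substTZ, map_mul, map_mul]
  rfl

theorem substTZ_pow (e : ℕ) (F : (Polynomial ℂ)⟦X⟧) (n : ℕ) :
    substTZ e (F ^ n) = substTZ e F ^ n := by
  rw [substTZ, map_pow, map_pow]
  rfl

theorem substTZ_map_C (e : ℕ) (φ : ℂ⟦X⟧) :
    substTZ e (PowerSeries.map Polynomial.C φ) = substZ e φ := by
  ext1 k
  rw [coeff_substTZ, substZ, PowerSeries.coeff_rescale, PowerSeries.coeff_map,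
    PowerSeries.coeff_map, Polynomial.aeval_C, ← pow_mul]
  rfl

theorem constantCoeff_substZ {φ : ℂ⟦X⟧} (hφ : PowerSeries.constantCoeff φ = 0) (e : ℕ) :
    PowerSeries.constantCoeff (substZ e φ) = 0 := by
  rw [← PowerSeries.coeff_zero_eq_constantCoeff_apply, substZ, PowerSeries.coeff_rescale,
    PowerSeries.coeff_map, PowerSeries.coeff_zero_eq_constantCoeff_apply, hφ, map_zero, mul_zero]

/-- The substitution is multiplicative, and every coefficient of the exponential is a finite sum of
powers, so it passes through exp. -/
theorem substTZ_riordanEGF (e : ℕ) {h : ℂ⟦X⟧} (hh : PowerSeries.constantCoeff h = 0) (d : ℂ⟦X⟧) :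
    substTZ e (riordanEGF d h) = substZ e d * expWc (als * al) (substZ e h) := by
  have hC : substTZ e (PowerSeries.C (Polynomial.X : Polynomial ℂ) *
      PowerSeries.map Polynomial.C h) = PowerSeries.C (als * al) * substZ e h := by
    rw [substTZ_mul, substTZ_map_C]
    congr 1
    ext1 k
    rw [coeff_substTZ, PowerSeries.coeff_C, PowerSeries.coeff_C]
    split_ifs with hk
    · rw [hk, mul_zero, pow_zero, one_mul, Polynomial.aeval_X]
    · rw [map_zero, mul_zero]
  rw [riordanEGF, substTZ_mul, substTZ_map_C, expWc]
  congr 1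
  ext1 k
  rw [coeff_substTZ, coeff_exp_subst, coeff_exp_subst, map_sum, Finset.mul_sum]
  · refine Finset.sum_congr rfl fun j _ => ?_
    rw [map_smul, mul_smul_comm, ← coeff_substTZ, substTZ_pow, hC]
  · rw [map_mul, constantCoeff_substZ hh, mul_zero]
  · rw [map_mul, ← PowerSeries.coeff_zero_eq_constantCoeff_apply (PowerSeries.map _ _),
      PowerSeries.coeff_map, PowerSeries.coeff_zero_eq_constantCoeff_apply, hh, map_zero, mul_zero]

theorem substZ_neg (e : ℕ) (φ : ℂ⟦X⟧) : substZ e (-φ) = -substZ e φ := by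
  rw [substZ, map_neg, map_neg]
  rfl

/-! ### The exponential of the generator -/

theorem coeff_sOrder_substTZ (s : ℂ) (e : ℕ) (F : (Polynomial ℂ)⟦X⟧) (k : ℕ) :
    PowerSeries.coeff k (sOrder s (substTZ e F)) =
      quantizeDiag (ordered ((1 + s) / 2)) (e * k) (PowerSeries.coeff k F) := by
  rw [sOrder, quantizeSeries, PowerSeries.coeff_mk, coeff_substTZ, sMonomial_eq,
    quantizeDiag_apply]

theorem expLambda_eq_sOrder {L R e : ℕ} (he : L + R = e + 1) (s : ℂ) :
    expLambda (adag ^ L * a * adag ^ R) = sOrder s (substTZ e (twoPointEGF e 1 (-L) R s)) := by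
  have hh := constantCoeff_fTbar e 1 s
  have hA := derivative_eq_of_relations hh (fTbar_relation e s) (derivative_fTbar_mul e s)
  have hB := derivative_eq_of_relations' he hh hA (derivative_fTbar_mul e s)
    (gTbar_mul_mixedPow he s)
  ext k
  rw [coeff_sOrder_substTZ, expLambda, PowerSeries.coeff_mk]
  induction k with
  | zero =>
    have h1 : PowerSeries.coeff 0 (twoPointEGF e 1 (-L) R s) = 1 := by
      ext j
      rw [twoPointEGF, coeff_coeff_riordanEGF hh, PowerSeries.coeff_zero_eq_constantCoeff_apply,
        map_mul, map_pow, hh, constantCoeff_gTbar, one_mul, Polynomial.coeff_one]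
      split_ifs with hj
      · simp [hj]
      · rw [zero_pow hj, mul_zero]
    have h2 := quantizeDiag_X_pow (ordered ((1 + s) / 2)) 0 0
    rw [pow_zero] at h2
    rw [h1, mul_zero, h2]
    simp [ordered_zero_left]
  | succ k ih =>
    have hk : (k : ℂ) + 1 ≠ 0 := by exact_mod_cast k.succ_ne_zero
    -- Both sides satisfy (k+1) c_(k+1) = G c_k, and k + 1 can be cancelled.
    apply smul_right_injective W hk
    beta_reduce
    rw [twoPointEGF] at ih ⊢
    rw [← generator_mul_quantizeDiag he _ hh hA hB, ← ih, mul_smul_comm, ← pow_succ', smul_smul,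
      Nat.factorial_succ]
    congr 1
    have : (k.factorial : ℂ) ≠ 0 := by exact_mod_cast k.factorial_ne_zero
    push_cast
    field_simp

theorem sOrder_neg_one : sOrder (-1) = normalOrder := by
  have h : sMonomial (-1) = fun n m => adag ^ n * a ^ m := by
    rw [sMonomial_eq]
    ext n m
    rw [show (1 + -1 : ℂ) / 2 = 0 by ring, ordered_zero]
  rw [sOrder, h]
  rfl

theorem sOrder_one : sOrder 1 = antiNormalOrder := by
  have h : sMonomial 1 = fun n m => a ^ m * adag ^ n := by
    rw [sMonomial_eq]
    ext n m
    rw [show (1 + 1 : ℂ) / 2 = 1 by ring, ordered_one]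
  rw [sOrder, h]
  rfl

/-! ### Normal and anti-normal forms -/

/-- Used with n = 1 to identify f̄_T, and with n = R or n = L to identify ḡ_T. -/
theorem pow_eq_stridePow {e : ℕ} {u Y : ℂ⟦X⟧} (hu : PowerSeries.constantCoeff u = 0) {c : ℂ}
    (hY : (1 + PowerSeries.C (e : ℂ) * u) * PowerSeries.derivative ℂ Y =
      PowerSeries.C c * PowerSeries.derivative ℂ u * Y)
    (hY0 : PowerSeries.constantCoeff Y = 1) (n : ℕ) : Y ^ n = stridePow e u (c * n) := by
  have hne : Y ≠ 0 := fun h => by simp [h] at hY0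
  refine eq_stridePow hu (mul_left_cancel₀ hne ?_) (by simp [hY0])
  rw [map_mul]
  linear_combination (1 + PowerSeries.C (e : ℂ) * u) * derivative_pow_mul_self Y n +
    PowerSeries.C (n : ℂ) * Y ^ n * hY

/-- At p = 0 the relations read e z Q^e = Q^e - 1 and h' = Q^(e+1) for Q = 1 + h, whence (1 - e z)
Q' = Q. -/
theorem fTbar_neg_one (e : ℕ) :
    (1 + PowerSeries.C (e : ℂ) * -PowerSeries.X) * PowerSeries.derivative ℂ (1 + fTbar e 1 (-1)) =
      PowerSeries.C (-1) * PowerSeries.derivative ℂ (-PowerSeries.X) * (1 + fTbar e 1 (-1)) := by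
  have h1 := fTbar_relation e (-1)
  have h2 := derivative_fTbar_mul e (-1)
  rw [mixedPow] at h2
  simp only [add_neg_cancel, zero_div, map_zero, zero_mul, sub_zero, map_one, one_mul, one_pow,
    zero_add, mul_one] at h1 h2
  rw [map_add, PowerSeries.derivative_one, zero_add, map_neg, map_neg, map_one,
    PowerSeries.derivative_X, h2]
  linear_combination (-(1 + fTbar e 1 (-1))) * h1

/-- At p = 1 the relations read e z P^e = 1 - P^e and h' = P^(e+1) for P = 1 - h, whence (1 + e z)
P' = -P. -/
theorem fTbar_one (e : ℕ) :
    (1 + PowerSeries.C (e : ℂ) * PowerSeries.X) * PowerSeries.derivative ℂ (1 - fTbar e 1 1) =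
      PowerSeries.C (-1) * PowerSeries.derivative ℂ PowerSeries.X * (1 - fTbar e 1 1) := by
  have h1 := fTbar_relation e 1
  have h2 := derivative_fTbar_mul e 1
  rw [mixedPow, show (1 + 1 : ℂ) / 2 = 1 by ring] at h2
  rw [show (1 + 1 : ℂ) / 2 = 1 by ring] at h1
  simp only [sub_self, map_zero, zero_mul, add_zero, map_one, one_mul, one_pow, mul_one] at h1 h2
  rw [map_sub, PowerSeries.derivative_one, zero_sub, map_neg, map_one, PowerSeries.derivative_X,
    h2]
  linear_combination (-(1 - fTbar e 1 1)) * h1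

theorem twoPointEGF_neg_one {L R e : ℕ} (he : L + R = e + 1) :
    substTZ e (twoPointEGF e 1 (-L) R (-1)) = normalForm e R := by
  have hh := constantCoeff_fTbar e 1 (-1)
  have hY := pow_eq_stridePow (by simp) (fTbar_neg_one e) (by simp [hh])
  have h1 := hY 1
  have hd := gTbar_mul_mixedPow he (-1)
  rw [mixedPow] at hd
  simp only [add_neg_cancel, zero_div, map_zero, zero_mul, sub_zero, map_one, one_mul, one_pow,
    zero_add, mul_one] at hd
  rw [twoPointEGF, substTZ_riordanEGF e hh, normalForm, hd, hY, neg_one_mul]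
  rw [pow_one, Nat.cast_one, mul_one] at h1
  rw [← h1, add_sub_cancel_left]

theorem twoPointEGF_one {L R e : ℕ} (he : L + R = e + 1) :
    substTZ e (twoPointEGF e 1 (-L) R 1) = antiNormalForm e L := by
  have hh := constantCoeff_fTbar e 1 1
  have hY := pow_eq_stridePow (by simp) (fTbar_one e) (by simp [hh])
  have h1 := hY 1
  have hd := gTbar_mul_mixedPow he 1
  rw [mixedPow, show (1 + 1 : ℂ) / 2 = 1 by ring] at hd
  simp only [sub_self, map_zero, zero_mul, add_zero, map_one, one_mul, one_pow, mul_one] at hd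
  rw [twoPointEGF, substTZ_riordanEGF e hh, antiNormalForm, hd, hY, neg_one_mul, mul_comm]
  rw [pow_one, Nat.cast_one, mul_one] at h1
  rw [← h1, sub_sub_cancel_left, substZ_neg, expWc, expWc, map_neg, neg_mul_neg, mul_comm al als]

end BosonOrdering

end

open BosonOrdering

theorem mainTheorem1 (L R e : ℕ) (he : L + R = e + 1) :
    -- the `s`-ordered form, for every complex `s`
    (∀ s : ℂ,
      -- `[ḡ_T, f̄_T]` is the two-sided Riordan-group inverse of `[g_T, f_T]`
      riordanMul (gT 1 (-L) R s, fT e 1 s) (gTbar e 1 (-L) R s, fTbar e 1 s)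
          = (1, PowerSeries.X) ∧
      riordanMul (gTbar e 1 (-L) R s, fTbar e 1 s) (gT 1 (-L) R s, fT e 1 s)
          = (1, PowerSeries.X) ∧
      expLambda (adag ^ L * a * adag ^ R)
          = sOrder s (substTZ e (twoPointEGF e 1 (-L) R s)) ∧
      expLambda (adag ^ L * a * adag ^ R)
          = sOrder s (substZ e (gTbar e 1 (-L) R s) *
              expWc (als * al) (substZ e (fTbar e 1 s)))) ∧
    -- the case `s = -1`
    (substTZ e (twoPointEGF e 1 (-L) R (-1)) = normalForm e R ∧
      expLambda (adag ^ L * a * adag ^ R) = normalOrder (normalForm e R)) ∧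
    -- the case `s = +1`
    (substTZ e (twoPointEGF e 1 (-L) R 1) = antiNormalForm e L ∧
      expLambda (adag ^ L * a * adag ^ R) = antiNormalOrder (antiNormalForm e L)) := by
  have h (s : ℂ) := expLambda_eq_sOrder he s
  refine ⟨fun s => ⟨riordanMul_right_inverse e L R s, riordanMul_left_inverse e L R s, h s, ?_⟩,
    ⟨twoPointEGF_neg_one he, ?_⟩, twoPointEGF_one he, ?_⟩
  · rw [h s, twoPointEGF, substTZ_riordanEGF e (constantCoeff_fTbar e 1 s)]
  · rw [h (-1), twoPointEGF_neg_one he, sOrder_neg_one]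
  · rw [h 1, twoPointEGF_one he, sOrder_one]
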